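/- Let $\kappa\ge 3$ be an integer and $a_\kappa=2\sqrt{\kappa-1}/\kappa$. For $\gamma\in\mathbb{R}$ consider the quantum walk with a reflecting wall at the origin: the state space has orthonormal basis $|x,L\rangle,|x,R\rangle$ ($x\in\mathbb{Z}$), the initial state is $\Psi_0=|0,L\rangle$, and $\Psi_{t+1}=\widetilde S\,\widetilde C\,\Psi_t$, where the shift is $\widetilde S|x,L\rangle=|x-1,L\rangle$, $\widetilde S|x,R\rangle=|x+1,R\rangle$, and the coin is given by $$\widetilde C|x,L\rangle=a_\kappa|x,L\rangle+(1-\tfrac2\kappa)|x,R\rangle,\qquad \widetilde C|x,R\rangle=-(1-\tfrac2\kappa)|x,L\rangle+a_\kappa|x,R\rangle\qquad(x\ne0),$$ $$\widetilde C|0,L\rangle=e^{i\gamma}|0,R\rangle,\qquad \widetilde C|0,R\rangle=e^{i\gamma}|0,L\rangle .$$ Let $X_t$ be a random variable with $P(X_t=x)=|\langle x,L|\Psi_t\rangle|^2+|\langle x,R|\Psi_t\rangle|^2$. Case (A) is $\gamma=0$ and Case (B) is $\gamma=\pi$. (These are the reductions to the half line of the Grover walk on the $\kappa$-regular Cayley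 tree started at the root with the uniform initial qubit and with the weighted uniform initial qubit, respectively.) Put $$f_\kappa(x)=(\kappa-2)\,\frac{x^2\,I_{[0,a_\kappa)}(x)}{\pi(1-x^2)\sqrt{a_\kappa^2-x^2}},\qquad C_\kappa(B)=\frac{\kappa-2}{\kappa-1}.$$ Then, as $t\to\infty$, $X_t/t$ converges weakly. In Case (A) the limit is the probability measure with density $f_\kappa$. In Case (B) the limit is the probability measure $C_\kappa(B)\,\delta_0+(1-C_\kappa(B))\,f_\kappa(x)\,dx$. Moreover $f_\kappa(x)=\kappa x^2\mu_K(x;a_\kappa)I_{[0,\infty)}(x)$ for all $x\in\mathbb{R}$, where $\mu_K(x;a)=\dfrac{\sqrt{1-a^2}}{\pi(1-x^2)\sqrt{a^2-x^2}}\,I_{(-|a|,|a|)}(x)$ is the Konno density function. -/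

import Mathlib

open MeasureTheory Filter Topology

noncomputable section

namespace WallWalk

/-- `a_κ = 2 √(κ - 1) / κ`. -/
def a (κ : ℕ) : ℝ := 2 * Real.sqrt ((κ : ℝ) - 1) / κ

/-- A family of amplitudes on `ℤ × {L, R}`: `ψ x 0` is the amplitude of `|x, L⟩` and
`ψ x 1` is the amplitude of `|x, R⟩`. -/
abbrev State : Type := ℤ → Fin 2 → ℂ

/-- The coin `H_κ` away from the origin, in the ordered basis `(|L⟩, |R⟩)`. -/
def coinMatrix (κ : ℕ) : Matrix (Fin 2) (Fin 2) ℂ :=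
  !![(a κ : ℂ), -(1 - 2 / (κ : ℂ)); 1 - 2 / (κ : ℂ), (a κ : ℂ)]

/-- The flip `σ`. -/
def flipMatrix : Matrix (Fin 2) (Fin 2) ℂ := !![0, 1; 1, 0]

/-- The position dependent coin `H(x)`: `e^{iγ} σ` at the origin, `H_κ` elsewhere. -/
def localCoin (κ : ℕ) (γ : ℝ) (x : ℤ) : Matrix (Fin 2) (Fin 2) ℂ :=
  if x = 0 then Complex.exp (γ * Complex.I) • flipMatrix else coinMatrix κ

/-- The coin operation `|x, A⟩ ↦ |x⟩ ⊗ H(x)|A⟩`. -/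
def coin (κ : ℕ) (γ : ℝ) (ψ : State) : State :=
  fun x => Matrix.mulVec (localCoin κ γ x) (ψ x)

/-- The shift operation `|x, L⟩ ↦ |x - 1, L⟩`, `|x, R⟩ ↦ |x + 1, R⟩`. -/
def shift (ψ : State) : State := fun x => ![ψ (x + 1) 0, ψ (x - 1) 1]

/-- The initial state `|0, L⟩`. -/
def initial : State := fun x => if x = 0 then ![1, 0] else 0

/-- The state `(shift ∘ coin)^t |0, L⟩` at time `t`. -/
def state (κ : ℕ) (γ : ℝ) (t : ℕ) : State := (fun ψ => shift (coin κ γ ψ))^[t] initial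

/-- The probability of finding the particle in state `ψ` at position `x`. -/
def prob (ψ : State) (x : ℤ) : ENNReal := ENNReal.ofReal (‖ψ x 0‖ ^ 2 + ‖ψ x 1‖ ^ 2)

theorem a_sq (κ : ℕ) : (a κ) ^ 2 + (1 - 2 / (κ : ℝ)) ^ 2 = 1 := by
  rcases Nat.eq_zero_or_pos κ with rfl | h
  · simp [a]
  · have h1 : (1 : ℝ) ≤ κ := by exact_mod_cast h
    have h2 : (κ : ℝ) ≠ 0 := by positivity
    rw [a, div_pow, mul_pow, Real.sq_sqrt (by linarith)]
    field_simp
    ring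

theorem prob_coin (κ : ℕ) (γ : ℝ) (ψ : State) (x : ℤ) :
    prob (coin κ γ ψ) x = prob ψ x := by
  unfold prob
  congr 1
  unfold coin localCoin
  split_ifs with h
  · simp [flipMatrix, Matrix.mulVec, dotProduct, Fin.sum_univ_two, Complex.norm_exp, add_comm]
  · have hs := a_sq κ
    have e : (1 - 2 / (κ : ℂ)) = ((1 - 2 / (κ : ℝ) : ℝ) : ℂ) := by push_cast; rfl
    simp only [coinMatrix, e, Matrix.mulVec, dotProduct, Fin.sum_univ_two, Matrix.of_apply,
      Matrix.cons_val', Matrix.cons_val_zero, Matrix.cons_val_one, Matrix.cons_val_fin_one]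
    generalize 1 - 2 / (κ : ℝ) = b at hs
    generalize a κ = c at hs
    simp only [← Complex.normSq_eq_norm_sq, Complex.normSq_apply, Complex.add_re, Complex.add_im,
      Complex.mul_re, Complex.mul_im, Complex.ofReal_re, Complex.ofReal_im, Complex.neg_re,
      Complex.neg_im]
    linear_combination ((ψ x 0).re ^ 2 + (ψ x 0).im ^ 2 + (ψ x 1).re ^ 2 + (ψ x 1).im ^ 2) * hs

theorem tsum_prob (ψ : State) :
    ∑' x, prob ψ x = ∑' x, ENNReal.ofReal (‖ψ x 0‖ ^ 2) + ∑' x, ENNReal.ofReal (‖ψ x 1‖ ^ 2) := by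
  rw [← ENNReal.tsum_add]
  exact tsum_congr fun x => ENNReal.ofReal_add (by positivity) (by positivity)

theorem tsum_prob_shift (ψ : State) : ∑' x, prob (shift ψ) x = ∑' x, prob ψ x := by
  rw [tsum_prob, tsum_prob]
  congr 1
  · exact (Equiv.addRight (1 : ℤ)).tsum_eq fun x => ENNReal.ofReal (‖ψ x 0‖ ^ 2)
  · exact (Equiv.subRight (1 : ℤ)).tsum_eq fun x => ENNReal.ofReal (‖ψ x 1‖ ^ 2)

theorem tsum_prob_state (κ : ℕ) (γ : ℝ) (t : ℕ) : ∑' x, prob (state κ γ t) x = 1 := by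
  induction t with
  | zero =>
    rw [tsum_eq_single 0]
    · simp [state, prob, initial]
    · intro x hx
      simp [state, prob, initial, hx]
  | succ t ih =>
    rw [state, Function.iterate_succ_apply', ← state, tsum_prob_shift]
    simp only [prob_coin, ih]

/-- The distribution of the position `X_t`:
`P(X_t = x) = |⟨x, L|ψ_t⟩|² + |⟨x, R|ψ_t⟩|²`. -/
def law (κ : ℕ) (γ : ℝ) (t : ℕ) : PMF ℤ :=
  ⟨prob (state κ γ t), tsum_prob_state κ γ t ▸ ENNReal.summable.hasSum⟩

/-- The distribution of the rescaled position `X_t / t` on the real line. -/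
def rescaledLaw (κ : ℕ) (γ : ℝ) (t : ℕ) : ProbabilityMeasure ℝ :=
  ⟨(law κ γ t).toMeasure.map (fun x : ℤ => (x : ℝ) / t),
    Measure.isProbabilityMeasure_map (measurable_of_countable _).aemeasurable⟩

/-- `f_κ(x) = (κ - 2) x² I_{[0, a_κ)}(x) / (π (1 - x²) √(a_κ² - x²))`. -/
def f (κ : ℕ) (x : ℝ) : ℝ :=
  ((κ : ℝ) - 2) * (x ^ 2 * (Set.Ico 0 (a κ)).indicator 1 x /
    (Real.pi * (1 - x ^ 2) * Real.sqrt (a κ ^ 2 - x ^ 2)))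

/-- The Konno density function
`μ_K(x; r) = √(1 - r²) I_{(-|r|, |r|)}(x) / (π (1 - x²) √(r² - x²))`. -/
def konnoDensity (x r : ℝ) : ℝ :=
  Real.sqrt (1 - r ^ 2) / (Real.pi * (1 - x ^ 2) * Real.sqrt (r ^ 2 - x ^ 2)) *
    (Set.Ioo (-|r|) |r|).indicator 1 x

/-- The measure on the real line with density `f_κ`. -/
def densityMeasure (κ : ℕ) : Measure ℝ :=
  volume.withDensity fun x => ENNReal.ofReal (f κ x)

/-- The localized mass `C_κ(B) = (κ - 2) / (κ - 1)`. -/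
def C (κ : ℕ) : ℝ := ((κ : ℝ) - 2) / ((κ : ℝ) - 1)

/-- The limit measure `C_κ(B) δ_0 + (1 - C_κ(B)) f_κ`. -/
def mixedMeasure (κ : ℕ) : Measure ℝ :=
  ENNReal.ofReal (C κ) • Measure.dirac 0 + ENNReal.ofReal (1 - C κ) • densityMeasure κ

end WallWalk

end

/-!
Away from the wall the walk is homogeneous, so it is solved by the Fourier transform: its evolution
at momentum `k` has eigenvalues `e^{± i ω(k)}` with `cos ω = a cos k`, and a packet of momentum `k`
moves with the group velocity `v = ω' = a sin k / sin ω` or with `-v`. Only the wall has to be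
removed, and this is done by a method of images.

Write `ε = e^{iγ} = ±1`, `b = 1 - 2/κ` and `c = (ε - b) / a`. A walk on the full line without wall
whose amplitudes satisfy `R(0) = c L(0)` at all times restricts to the reflected walk on the half
line (`state_eq`). The free walk with initial state `ℓ(k) (1, c)` in momentum space, where
`ℓ(k) = (1 - e^{2ik}) / (1 - c² e^{2ik})`, has this property, because `R - c L` is an odd function
of `k` at all times (`WallData.waveR_sub`). If `γ = 0`, then `c² < 1` and `ℓ` expands in non-negative
powers of `e^{ik}`, so that this state restricts to `|0, L⟩` (`amplitude_profile_of_lt_one`). If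
`γ = π`, then `c² > 1`, the expansion is in negative powers, and the restriction misses `|0, L⟩` by
a multiple of the even part of `(1, c) ρ ^ x`, `ρ = ε / c` (`amplitude_profile_of_one_lt`). This
part is the sum of the two bound states with eigenvalues `± 1`; it does not spread, and it is the
source of the atom at `0`.

The vector `(1, c)` has equal weight on the two eigenvectors of the evolution at every `k`, and
`(1 + c²) |ℓ(k)|² = 2 / (1 - ε b) · v(k)²` (`WallData.norm_sq_profile`). By Parseval's identity,
the characteristic function at `ξ / t` of the position of the free walk is an integral over `k` of
the inner products of the waves at the momenta `k + ξ / t` and `k`, and it converges to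
`(2π)⁻¹ ∫ 2 / (1 - ε b) v² cos (ξ v) dk` (`WallData.tendsto_tsum_waveMass`). Hence, by Lévy's
continuity theorem, the free walk divided by `t` converges in distribution to `v(k)`, with `k`
distributed proportionally to `v(k)²` (`WallData.tendsto_rescaledWaveLaw`).

For a bounded continuous `g`, the function `g (max x 0) - g 0` vanishes on the left half line and
at `0`. So its mean is the same for the reflected walk as for the free walk, up to the contribution
of the bound states, which is concentrated near `0` and disappears in the limit
(`tendsto_integral_rescaledLaw`). The substitution `x = v(k)` gives the density `f κ`
(`integral_densityMeasure`).
-/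

noncomputable section

namespace WallWalk

open Complex ComplexConjugate

/-! ### Amplitudes of wave packets -/

/-- The amplitude at site `x` of the wave packet with profile `F` in momentum space:
`(2π)⁻¹ ∫_{-π}^{π} e^{ikx} F(k) dk`, the Fourier coefficient of `F` of index `-x`. -/
def amplitude (F : ℝ → ℂ) (x : ℤ) : ℂ :=
  (2 * (Real.pi : ℂ))⁻¹ * ∫ k in (-Real.pi)..Real.pi, exp (x * k * I) * F k

theorem amplitude_eq_fourierCoeffOn (F : ℝ → ℂ) (x : ℤ) (h : -Real.pi < Real.pi) :
    amplitude F x = fourierCoeffOn h F (-x) := by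
  rw [fourierCoeffOn_eq_integral, amplitude]
  rw [Complex.real_smul]
  congr 1
  · push_cast
    rw [sub_neg_eq_add, one_div, two_mul]
  · refine intervalIntegral.integral_congr fun k _ => ?_
    have hp : (Real.pi : ℂ) ≠ 0 := by exact_mod_cast Real.pi_ne_zero
    simp only [fourier_coe_apply, smul_eq_mul]
    congr 2
    push_cast
    field_simp
    ring

theorem amplitude_add {F G : ℝ → ℂ} (hF : Continuous F) (hG : Continuous G) (x : ℤ) :
    amplitude (fun k => F k + G k) x = amplitude F x + amplitude G x := by
  unfold amplitude
  simp only [mul_add]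
  rw [intervalIntegral.integral_add, mul_add]
  · apply Continuous.intervalIntegrable
    fun_prop
  · apply Continuous.intervalIntegrable
    fun_prop

theorem amplitude_const_mul (r : ℂ) (F : ℝ → ℂ) (x : ℤ) :
    amplitude (fun k => r * F k) x = r * amplitude F x := by
  unfold amplitude
  rw [mul_left_comm r, ← intervalIntegral.integral_const_mul r]
  congr 1
  refine intervalIntegral.integral_congr fun k _ => ?_
  ring

theorem amplitude_exp_mul (n : ℤ) (F : ℝ → ℂ) (x : ℤ) :
    amplitude (fun k => exp (n * k * I) * F k) x = amplitude F (x + n) := by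
  unfold amplitude
  congr 1
  refine intervalIntegral.integral_congr fun k _ => ?_
  simp only
  rw [← mul_assoc, ← Complex.exp_add]
  congr 2
  push_cast
  ring

/-- A translation in momentum space multiplies the amplitudes by a phase. -/
theorem amplitude_translate {F : ℝ → ℂ} (hF : Function.Periodic F (2 * Real.pi)) (η : ℝ) (x : ℤ) :
    amplitude (fun k => F (k + η)) x = exp (-(x * η * I)) * amplitude F x := by
  have hper : Function.Periodic (fun k : ℝ => exp (x * k * I) * F k) (2 * Real.pi) := by
    intro k
    simp only [hF k]
    congr 1
    rw [Complex.exp_eq_exp_iff_exists_int]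
    exact ⟨x, by push_cast; ring⟩
  have h1 := hper.intervalIntegral_add_eq (-Real.pi + η) (-Real.pi)
  have h2 : -Real.pi + η + 2 * Real.pi = Real.pi + η := by ring
  have h3 : -Real.pi + 2 * Real.pi = Real.pi := by ring
  rw [h2, h3, ← intervalIntegral.integral_comp_add_right (fun k : ℝ => exp (x * k * I) * F k)] at h1
  rw [amplitude, amplitude, ← h1, mul_left_comm (exp (-(x * η * I))),
    ← intervalIntegral.integral_const_mul (exp (-(x * η * I)))]
  congr 1
  refine intervalIntegral.integral_congr fun k _ => ?_
  rw [← mul_assoc, ← Complex.exp_add]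
  congr 2
  push_cast
  ring

theorem norm_amplitude_le {F : ℝ → ℂ} {K : ℝ} (hF : ∀ k, ‖F k‖ ≤ K) (x : ℤ) :
    ‖amplitude F x‖ ≤ K := by
  have hp := Real.pi_pos
  have h1 : ‖∫ k in (-Real.pi)..Real.pi, exp (x * k * I) * F k‖ ≤
      K * |Real.pi - -Real.pi| := by
    refine intervalIntegral.norm_integral_le_of_norm_le_const fun k _ => ?_
    have h2 : ‖exp ((x : ℂ) * k * I)‖ = 1 := by
      have := Complex.norm_exp_ofReal_mul_I ((x : ℝ) * k)
      push_cast at this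
      exact this
    rw [norm_mul, h2, one_mul]
    exact hF k
  have h3 : |Real.pi - -Real.pi| = 2 * Real.pi := by
    rw [abs_of_pos (by linarith)]; ring
  rw [h3] at h1
  have h4 : ‖(2 * (Real.pi : ℂ))⁻¹‖ = (2 * Real.pi)⁻¹ := by
    rw [norm_inv, norm_mul, Complex.norm_real, Real.norm_of_nonneg hp.le]
    simp
  rw [amplitude, norm_mul, h4]
  calc (2 * Real.pi)⁻¹ * _ ≤ (2 * Real.pi)⁻¹ * (K * (2 * Real.pi)) := by gcongr
    _ = K := by field_simp

theorem amplitude_zero_of_odd {F : ℝ → ℂ} (hF : ∀ k, F (-k) = -F k) : amplitude F 0 = 0 := by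
  have h : ∫ k in (-Real.pi)..Real.pi, F k = 0 := by
    have h1 := intervalIntegral.integral_comp_neg (a := -Real.pi) (b := Real.pi) F
    simp only [hF, intervalIntegral.integral_neg, neg_neg] at h1
    have h2 : 2 * ∫ k in (-Real.pi)..Real.pi, F k = 0 := by linear_combination -h1
    simpa using h2
  simp [amplitude, h]

theorem amplitude_one (x : ℤ) : amplitude (fun _ => 1) x = if x = 0 then 1 else 0 := by
  have hp : (Real.pi : ℂ) ≠ 0 := by exact_mod_cast Real.pi_ne_zero
  split_ifs with h
  · subst h
    simp only [amplitude, Int.cast_zero, zero_mul, Complex.exp_zero, mul_one,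
      intervalIntegral.integral_const, Complex.real_smul]
    push_cast
    field_simp
    norm_num
  · have hx : (x : ℂ) * I ≠ 0 := mul_ne_zero (by exact_mod_cast h) I_ne_zero
    have h1 : ∀ k : ℝ, exp ((x : ℂ) * k * I) * 1 = exp ((x : ℂ) * I * k) := by
      intro k; rw [mul_one]; congr 1; ring
    simp only [amplitude, h1]
    rw [integral_exp_mul_complex hx]
    have h2 : exp ((x : ℂ) * I * (Real.pi : ℝ)) = exp ((x : ℂ) * I * ((-Real.pi : ℝ) : ℂ)) := by
      rw [Complex.exp_eq_exp_iff_exists_int]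
      exact ⟨x, by push_cast; ring⟩
    rw [h2]
    simp

/-- **Parseval's identity** for amplitudes. -/
theorem hasSum_conj_amplitude_mul {F G : ℝ → ℂ} (hF : Continuous F) (hG : Continuous G) :
    HasSum (fun x => conj (amplitude F x) * amplitude G x)
      ((2 * (Real.pi : ℂ))⁻¹ * ∫ k in (-Real.pi)..Real.pi, conj (F k) * G k) := by
  have hp : -Real.pi < Real.pi := by linarith [Real.pi_pos]
  have hT := Fact.mk (by linarith : 0 < Real.pi - -Real.pi)
  have key : ∀ F : ℝ → ℂ, Continuous F → MemLp (AddCircle.liftIoc (Real.pi - -Real.pi) (-Real.pi) F)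
      2 (@AddCircle.haarAddCircle _ hT) := by
    intro F hF
    obtain ⟨K, hK⟩ := isCompact_Icc.exists_bound_of_continuousOn
      (s := Set.Icc (-Real.pi) (-Real.pi + (Real.pi - -Real.pi))) hF.continuousOn
    have hL : MemLp F 2 (volume.restrict (Set.Ioc (-Real.pi) (-Real.pi + (Real.pi - -Real.pi)))) :=
      MemLp.of_bound hF.aestronglyMeasurable K
        (ae_restrict_of_forall_mem measurableSet_Ioc fun x hx => hK x ⟨hx.1.le, hx.2⟩)
    exact hL.memLp_liftIoc.haarAddCircle
  have h := fourierBasis.hasSum_inner_mul_inner (key F hF).toLp (key G hG).toLp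
  rw [← (Equiv.neg ℤ).hasSum_iff] at h
  have h1 : (fun x => conj (amplitude F x) * amplitude G x) =
      (fun i => inner ℂ (key F hF).toLp (fourierBasis i) *
        inner ℂ (fourierBasis i) (key G hG).toLp) ∘ (Equiv.neg ℤ) := by
    funext x
    rw [amplitude_eq_fourierCoeffOn _ _ hp, amplitude_eq_fourierCoeffOn _ _ hp]
    have h2 : ∀ (F : ℝ → ℂ) (hF : Continuous F), fourierCoeffOn hp F (-x) =
        inner ℂ (fourierBasis (-x)) (key F hF).toLp := by
      intro F hF
      rw [← fourierBasis.repr_apply_apply, fourierBasis_repr,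
        fourierCoeff_congr_ae (key F hF).coeFn_toLp]
      rfl
    rw [h2 F hF, h2 G hG, inner_conj_symm]
    rfl
  have h3 : (2 * (Real.pi : ℂ))⁻¹ * ∫ k in (-Real.pi)..Real.pi, conj (F k) * G k =
      inner ℂ (key F hF).toLp (key G hG).toLp := by
    rw [L2.inner_def]
    have h4 : ∫ k in (-Real.pi)..Real.pi, conj (F k) * G k =
        ∫ k in (-Real.pi)..(-Real.pi + (Real.pi - -Real.pi)), conj (F k) * G k := by
      rw [add_sub_cancel]
    have h5 : (2 * (Real.pi : ℂ))⁻¹ = (((Real.pi - -Real.pi)⁻¹ : ℝ) : ℂ) := by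
      push_cast; ring_nf
    rw [h4, ← AddCircle.integral_liftIoc_eq_intervalIntegral, h5, ← Complex.real_smul,
      ← AddCircle.integral_haarAddCircle]
    refine integral_congr_ae ?_
    filter_upwards [(key F hF).coeFn_toLp, (key G hG).coeFn_toLp] with x hx hy
    rw [hx, hy, RCLike.inner_apply']
    rfl
  rw [h1, h3]
  exact h

/-! ### The initial profile -/

theorem norm_exp_two_mul (k : ℝ) : ‖exp (2 * k * I)‖ = 1 := by
  have := Complex.norm_exp_ofReal_mul_I (2 * k)
  push_cast at this
  exact this

theorem abs_one_sub_le_norm {r : ℝ} (hr : 0 ≤ r) (k : ℝ) : |1 - r| ≤ ‖1 - r * exp (2 * k * I)‖ := by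
  have h := abs_norm_sub_norm_le (1 : ℂ) (r * exp (2 * k * I))
  rwa [norm_mul, norm_exp_two_mul, Complex.norm_real, Real.norm_of_nonneg hr, norm_one,
    mul_one] at h

theorem one_sub_mul_exp_ne_zero {r : ℝ} (hr : 0 ≤ r) (h1 : r ≠ 1) (k : ℝ) :
    1 - r * exp (2 * k * I) ≠ 0 := by
  rw [← norm_pos_iff]
  exact (abs_pos.mpr (sub_ne_zero.mpr h1.symm)).trans_le (abs_one_sub_le_norm hr k)

/-- The geometric profile `k ↦ (1 - r e^{2ik})⁻¹`. -/
def geometricProfile (r k : ℝ) : ℂ := (1 - r * exp (2 * k * I))⁻¹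

theorem continuous_geometricProfile {r : ℝ} (hr : 0 ≤ r) (h1 : r ≠ 1) :
    Continuous (geometricProfile r) := by
  unfold geometricProfile
  exact Continuous.inv₀ (by fun_prop) (one_sub_mul_exp_ne_zero hr h1)

theorem norm_geometricProfile_le {r : ℝ} (hr : 0 ≤ r) (h1 : r ≠ 1) (k : ℝ) :
    ‖geometricProfile r k‖ ≤ |1 - r|⁻¹ := by
  rw [geometricProfile, norm_inv]
  exact inv_anti₀ (abs_pos.mpr (sub_ne_zero.mpr h1.symm)) (abs_one_sub_le_norm hr k)

theorem amplitude_exp_two_mul (F : ℝ → ℂ) (x : ℤ) :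
    amplitude (fun k => exp (2 * k * I) * F k) x = amplitude F (x + 2) := by
  have := amplitude_exp_mul 2 F x
  push_cast at this
  exact this

theorem amplitude_geometricProfile_sub {r : ℝ} (hr : 0 ≤ r) (h1 : r ≠ 1) (x : ℤ) :
    amplitude (geometricProfile r) x - r * amplitude (geometricProfile r) (x + 2) =
      if x = 0 then 1 else 0 := by
  have hc := continuous_geometricProfile hr h1
  rw [← amplitude_one, ← amplitude_exp_two_mul, sub_eq_add_neg, ← neg_mul, ← amplitude_const_mul,
    ← amplitude_add hc (by fun_prop)]
  congr 1
  funext k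
  have := one_sub_mul_exp_ne_zero hr h1 k
  rw [geometricProfile]
  field_simp
  ring

theorem eq_zero_of_norm_le_pow {u : ℂ} {q K : ℝ} (hq : 0 ≤ q) (hq1 : q < 1)
    (h : ∀ j : ℕ, ‖u‖ ≤ q ^ j * K) : u = 0 := by
  have h1 : Tendsto (fun j : ℕ => q ^ j * K) atTop (𝓝 (0 * K)) :=
    (tendsto_pow_atTop_nhds_zero_of_lt_one hq hq1).mul_const K
  have h2 := ge_of_tendsto' h1 h
  rw [zero_mul] at h2
  exact norm_le_zero_iff.mp h2

/-- For `r < 1` the geometric profile expands in non-negative powers of `e^{ik}`, hence lives on the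
left half line. -/
theorem amplitude_geometricProfile_of_lt_one {r : ℝ} (hr : 0 ≤ r) (h1 : r < 1) {x : ℤ}
    (hx : 0 < x) : amplitude (geometricProfile r) x = 0 := by
  have hK := norm_amplitude_le (norm_geometricProfile_le hr h1.ne)
  refine eq_zero_of_norm_le_pow (K := |1 - r|⁻¹) hr h1 fun j => ?_
  induction j generalizing x with
  | zero => simpa using hK x
  | succ j ih =>
    have h2 := amplitude_geometricProfile_sub hr h1.ne x
    rw [if_neg hx.ne', sub_eq_zero] at h2
    rw [h2, norm_mul, Complex.norm_real, Real.norm_of_nonneg hr, pow_succ', mul_assoc]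
    exact mul_le_mul_of_nonneg_left (ih (by omega)) hr

/-- For `r > 1` the geometric profile expands in negative powers of `e^{ik}`. -/
theorem amplitude_geometricProfile_of_one_lt {r : ℝ} (h1 : 1 < r) {x : ℤ}
    (hx : x < 2) : amplitude (geometricProfile r) x = 0 := by
  have hr : 0 < r := by linarith
  have hK := norm_amplitude_le (norm_geometricProfile_le hr.le h1.ne')
  refine eq_zero_of_norm_le_pow (q := r⁻¹) (K := |1 - r|⁻¹) (by positivity)
    (inv_lt_one_of_one_lt₀ h1) fun j => ?_
  induction j generalizing x with
  | zero => simpa using hK x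
  | succ j ih =>
    have h2 := amplitude_geometricProfile_sub hr.le h1.ne' (x - 2)
    rw [if_neg (by omega), sub_eq_zero, sub_add_cancel] at h2
    have h3 : amplitude (geometricProfile r) x =
        ((r⁻¹ : ℝ) : ℂ) * amplitude (geometricProfile r) (x - 2) := by
      rw [h2]
      have : (r : ℂ) ≠ 0 := by exact_mod_cast hr.ne'
      push_cast
      field_simp
    rw [h3, norm_mul, Complex.norm_real, Real.norm_of_nonneg (by positivity), pow_succ', mul_assoc]
    exact mul_le_mul_of_nonneg_left (ih (by omega)) (by positivity)

/-- The momentum profile `(1 - e^{2ik}) / (1 - c² e^{2ik})` of the initial `L` amplitudes of the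
full line walk whose restriction to the half line is the reflected walk. -/
def profile (c k : ℝ) : ℂ := (1 - exp (2 * k * I)) * geometricProfile (c ^ 2) k

theorem continuous_profile {c : ℝ} (h1 : c ^ 2 ≠ 1) : Continuous (profile c) := by
  have := continuous_geometricProfile (sq_nonneg c) h1
  unfold profile
  fun_prop

theorem norm_profile_le {c : ℝ} (h1 : c ^ 2 ≠ 1) (k : ℝ) : ‖profile c k‖ ≤ 2 * |1 - c ^ 2|⁻¹ := by
  rw [profile, norm_mul]
  refine mul_le_mul ?_ (norm_geometricProfile_le (sq_nonneg c) h1 k) (norm_nonneg _) (by norm_num)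
  refine (norm_sub_le _ _).trans ?_
  rw [norm_exp_two_mul, norm_one]
  norm_num

theorem periodic_profile (c : ℝ) : Function.Periodic (profile c) (2 * Real.pi) := by
  intro k
  have h : exp (2 * (k + 2 * Real.pi : ℝ) * I) = exp (2 * k * I) := by
    rw [Complex.exp_eq_exp_iff_exists_int]
    exact ⟨2, by push_cast; ring⟩
  rw [profile, profile, geometricProfile, geometricProfile, h]

theorem amplitude_profile {c : ℝ} (h1 : c ^ 2 ≠ 1) (x : ℤ) :
    amplitude (profile c) x = amplitude (geometricProfile (c ^ 2)) x -
      amplitude (geometricProfile (c ^ 2)) (x + 2) := by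
  have hc := continuous_geometricProfile (sq_nonneg c) h1
  rw [← amplitude_exp_two_mul, sub_eq_add_neg, ← neg_one_mul, ← amplitude_const_mul,
    ← amplitude_add hc (by fun_prop)]
  congr 1
  funext k
  rw [profile]
  ring

theorem amplitude_profile_of_lt_one {c : ℝ} (h1 : c ^ 2 < 1) (n : ℕ) :
    amplitude (profile c) n = if n = 0 then 1 else 0 := by
  have h2 := amplitude_geometricProfile_sub (sq_nonneg c) h1.ne n
  rw [amplitude_geometricProfile_of_lt_one (sq_nonneg c) h1 (by omega : 0 < (n : ℤ) + 2),
    mul_zero, sub_zero] at h2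
  rw [amplitude_profile h1.ne, h2,
    amplitude_geometricProfile_of_lt_one (sq_nonneg c) h1 (by omega : 0 < (n : ℤ) + 2)]
  simp

/-- For `c² > 1` the profile misses a multiple of the even part of the bound state
`x ↦ ρ ^ x`, `ρ² = c⁻²`. -/
theorem amplitude_profile_of_one_lt {c ρ : ℝ} (h1 : 1 < c ^ 2) (hρ : c ^ 2 * ρ ^ 2 = 1) (n : ℕ) :
    amplitude (profile c) n =
      (if n = 0 then 1 else 0) - if Even n then (1 - (c : ℂ)⁻¹ ^ 2) * (ρ : ℂ) ^ n else 0 := by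
  have hc : (c : ℂ) ≠ 0 := by
    rintro h
    have : c = 0 := by exact_mod_cast h
    rw [this] at h1
    norm_num at h1
  have hρ' : (c : ℂ) ^ 2 * (ρ : ℂ) ^ 2 = 1 := by exact_mod_cast hρ
  have hG := amplitude_geometricProfile_sub (sq_nonneg c) h1.ne'
  have hp := amplitude_profile h1.ne'
  push_cast at hG
  have h0 := @amplitude_geometricProfile_of_one_lt _ h1
  induction n using Nat.twoStepInduction with
  | zero =>
    have h2 := hG 0
    rw [h0 (by norm_num)] at h2
    simp only [zero_sub, if_true] at h2
    simp only [Nat.cast_zero, hp, h0 (by norm_num : (0 : ℤ) < 2)]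
    simp only [if_true, Even.zero, pow_zero]
    field_simp
    linear_combination h2
  | one =>
    have h2 := hG 1
    rw [h0 (by norm_num)] at h2
    simp [hc] at h2
    simp [hp, h0 (by norm_num : (1 : ℤ) < 2), h2]
  | more n ih _ =>
    have h2 := hG n
    have h3 := hG (n + 2)
    rw [if_neg (by omega)] at h3
    rw [hp] at ih ⊢
    push_cast
    have e : Even (n + 2) ↔ Even n := by simp [Nat.even_add]
    simp only [e]
    simp only [Nat.cast_eq_zero] at h2
    have h4 : (c : ℂ) ^ 2 * (amplitude (geometricProfile (c ^ 2)) (n + 2) -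
        amplitude (geometricProfile (c ^ 2)) (n + 2 + 2)) =
        -(if Even n then (1 - (c : ℂ)⁻¹ ^ 2) * (ρ : ℂ) ^ n else 0) := by
      linear_combination ih - h2 + h3
    have h5 : (c : ℂ) ^ 2 ≠ 0 := pow_ne_zero _ hc
    apply mul_left_cancel₀ h5
    rw [h4]
    split_ifs
    · linear_combination ((1 - (c : ℂ)⁻¹ ^ 2) * (ρ : ℂ) ^ n) * hρ'
    · simp

/-! ### The free walk in momentum space -/

/-- Parameters of the reflected walk: `a`, `b` are the entries of the bulk coin, `ε = e^{iγ} = ±1`,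
and `c` is the ratio which the boundary condition `R(0) = c L(0)` imposes on a full line walk whose
restriction to the half line follows the reflected walk. -/
structure WallData (a b c ε : ℝ) : Prop where
  a_pos : 0 < a
  b_pos : 0 < b
  sq_add_sq : a ^ 2 + b ^ 2 = 1
  eps_sq : ε ^ 2 = 1
  a_mul_c : a * c = ε - b

namespace WallData

variable {a b c ε : ℝ}

theorem b_lt_one (h : WallData a b c ε) : b < 1 := by nlinarith [h.a_pos, h.b_pos, h.sq_add_sq]

theorem a_sub (h : WallData a b c ε) : a - b * c = ε * c := by
  apply mul_left_cancel₀ h.a_pos.ne'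
  linear_combination (-b - ε) * h.a_mul_c + h.sq_add_sq - h.eps_sq

theorem b_add (h : WallData a b c ε) : b + a * c = ε := by linear_combination h.a_mul_c

theorem one_add_sq (h : WallData a b c ε) : (1 + c ^ 2) * a = 2 * (ε * c) := by
  linear_combination c * h.a_mul_c + h.a_sub

theorem c_ne_zero (h : WallData a b c ε) : c ≠ 0 := by
  rintro rfl
  have := h.one_add_sq
  simp at this
  exact h.a_pos.ne' this

theorem c_sq_ne_one (h : WallData a b c ε) : c ^ 2 ≠ 1 := by
  intro h1
  have h2 := h.one_add_sq
  rw [h1] at h2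
  have h3 : a * c = ε := by linear_combination c / 2 * h2 + ε * h1
  have := h.a_mul_c
  linarith [h.b_pos]

end WallData

/-- The sine `√(1 - a² cos² k)` of the frequency `arccos (a cos k)`. -/
def freqSin (a k : ℝ) : ℝ := Real.sqrt (1 - (a * Real.cos k) ^ 2)

/-- The dispersion relation of the free walk: the eigenvalues of its evolution at momentum `k` are
`e^{± i ω}` with `cos ω = a cos k`. -/
def freq (a k : ℝ) : ℝ := Real.arccos (a * Real.cos k)

/-- The group velocity, the derivative of the dispersion relation. -/
def velocity (a k : ℝ) : ℝ := a * Real.sin k / freqSin a k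

/-- The `L` component of the vector `d` orthogonal to `e = (1, c)` with
`U e = cos ω • e + sin ω • d`, where `U` is the evolution of the free walk at momentum `k`. -/
def quadL (a c ε k : ℝ) : ℂ := (ε * c * exp (k * I) - a * Real.cos k) / freqSin a k

/-- The `R` component of the vector `d` orthogonal to `e = (1, c)` with
`U e = cos ω • e + sin ω • d`. -/
def quadR (a c ε k : ℝ) : ℂ := (ε * exp (-k * I) - c * (a * Real.cos k)) / freqSin a k

/-- The `L` component in momentum space of the free walk started from `profile c • (1, c)`. -/
def waveL (a c ε : ℝ) (t : ℕ) (k : ℝ) : ℂ :=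
  profile c k * (Real.cos (t * freq a k) + Real.sin (t * freq a k) * quadL a c ε k)

/-- The `R` component in momentum space of the free walk started from `profile c • (1, c)`. -/
def waveR (a c ε : ℝ) (t : ℕ) (k : ℝ) : ℂ :=
  profile c k * (c * Real.cos (t * freq a k) + Real.sin (t * freq a k) * quadR a c ε k)

namespace WallData

variable {a b c ε : ℝ}

theorem sq_le (a k : ℝ) : (a * Real.cos k) ^ 2 ≤ a ^ 2 := by
  rw [mul_pow]
  exact mul_le_of_le_one_right (sq_nonneg a) (Real.cos_sq_le_one k)

theorem b_le_freqSin (h : WallData a b c ε) (k : ℝ) : b ≤ freqSin a k := by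
  apply Real.le_sqrt_of_sq_le
  have := sq_le a k
  linarith [h.sq_add_sq]

theorem freqSin_pos (h : WallData a b c ε) (k : ℝ) : 0 < freqSin a k := h.b_pos.trans_le (h.b_le_freqSin k)

theorem freqSin_sq (h : WallData a b c ε) (k : ℝ) : freqSin a k ^ 2 = 1 - (a * Real.cos k) ^ 2 := by
  apply Real.sq_sqrt
  have := sq_le a k
  nlinarith [h.sq_add_sq]

theorem abs_lt_one (h : WallData a b c ε) (k : ℝ) : |a * Real.cos k| < 1 := by
  rw [← sq_lt_one_iff_abs_lt_one]
  nlinarith [h.sq_add_sq, sq_le a k, h.b_pos]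

theorem cos_freq (h : WallData a b c ε) (k : ℝ) : Real.cos (freq a k) = a * Real.cos k := by
  have := abs_lt.mp (h.abs_lt_one k)
  exact Real.cos_arccos this.1.le this.2.le

theorem sin_freq (a k : ℝ) : Real.sin (freq a k) = freqSin a k := Real.sin_arccos _

theorem waveL_zero : waveL a c ε 0 = profile c := by
  funext k
  simp [waveL]

theorem waveR_zero : waveR a c ε 0 = fun k => c * profile c k := by
  funext k
  simp [waveR, mul_comm]

theorem cast_cos (k : ℝ) : (Real.cos k : ℂ) = (exp (k * I) + exp (-k * I)) / 2 := by
  rw [Complex.ofReal_cos, Complex.cos]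

theorem exp_mul_exp_neg (k : ℝ) : exp (k * I) * exp (-k * I) = 1 := by
  rw [← Complex.exp_add]
  simp

theorem freqSin_sq_complex (h : WallData a b c ε) (k : ℝ) :
    (freqSin a k : ℂ) ^ 2 = 1 - (a * Real.cos k) ^ 2 := by
  exact_mod_cast h.freqSin_sq k

theorem freqSin_ne_zero (h : WallData a b c ε) (k : ℝ) : (freqSin a k : ℂ) ≠ 0 := by
  exact_mod_cast (h.freqSin_pos k).ne'

/-- The `L` component of `U e = cos ω • e + sin ω • d`. -/
theorem evolve_e_L (h : WallData a b c ε) (k : ℝ) :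
    exp (k * I) * (a - b * c) = a * Real.cos k + freqSin a k * quadL a c ε k := by
  have h1 : (a : ℂ) - b * c = ε * c := by exact_mod_cast h.a_sub
  rw [quadL, mul_div_cancel₀ _ (h.freqSin_ne_zero k)]
  linear_combination exp (k * I) * h1

/-- The `R` component of `U e = cos ω • e + sin ω • d`. -/
theorem evolve_e_R (h : WallData a b c ε) (k : ℝ) :
    exp (-k * I) * (b + a * c) = c * (a * Real.cos k) + freqSin a k * quadR a c ε k := by
  have h1 : (b : ℂ) + a * c = ε := by exact_mod_cast h.b_add
  rw [quadR, mul_div_cancel₀ _ (h.freqSin_ne_zero k)]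
  linear_combination exp (-k * I) * h1

/-- The `L` component of `U d = cos ω • d - sin ω • e`. -/
theorem evolve_d_L (h : WallData a b c ε) (k : ℝ) :
    exp (k * I) * (a * quadL a c ε k - b * quadR a c ε k) =
      a * Real.cos k * quadL a c ε k - freqSin a k := by
  have h1 : (a : ℂ) - b * c = ε * c := by exact_mod_cast h.a_sub
  have h2 : (a : ℂ) * c = ε - b := by exact_mod_cast h.a_mul_c
  have h3 : (ε : ℂ) ^ 2 = 1 := by exact_mod_cast h.eps_sq
  have hS := h.freqSin_sq_complex k
  have hS0 := h.freqSin_ne_zero k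
  have hz := exp_mul_exp_neg k
  apply mul_left_cancel₀ hS0
  have e1 : (freqSin a k : ℂ) * (exp (k * I) * (a * quadL a c ε k - b * quadR a c ε k)) =
      exp (k * I) * (a * (freqSin a k * quadL a c ε k) - b * (freqSin a k * quadR a c ε k)) := by
    ring
  have e2 : (freqSin a k : ℂ) * (a * Real.cos k * quadL a c ε k - freqSin a k) =
      a * Real.cos k * (freqSin a k * quadL a c ε k) - freqSin a k ^ 2 := by ring
  rw [e1, e2, quadL, quadR, mul_div_cancel₀ _ hS0, mul_div_cancel₀ _ hS0, hS, cast_cos]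
  generalize exp (k * I) = z at *
  generalize exp (-k * I) = y at *
  linear_combination (-z * a * (z + y) / 2) * h1 + (-b * ε - a * ε * c) * hz - ε * h2 - h3

/-- The `R` component of `U d = cos ω • d - sin ω • e`. -/
theorem evolve_d_R (h : WallData a b c ε) (k : ℝ) :
    exp (-k * I) * (b * quadL a c ε k + a * quadR a c ε k) =
      a * Real.cos k * quadR a c ε k - freqSin a k * c := by
  have h1 : (a : ℂ) - b * c = ε * c := by exact_mod_cast h.a_sub
  have h2 : (a : ℂ) * c = ε - b := by exact_mod_cast h.a_mul_c
  have h3 : (ε : ℂ) ^ 2 = 1 := by exact_mod_cast h.eps_sq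
  have hS := h.freqSin_sq_complex k
  have hS0 := h.freqSin_ne_zero k
  have hz := exp_mul_exp_neg k
  apply mul_left_cancel₀ hS0
  have e1 : (freqSin a k : ℂ) * (exp (-k * I) * (b * quadL a c ε k + a * quadR a c ε k)) =
      exp (-k * I) * (b * (freqSin a k * quadL a c ε k) + a * (freqSin a k * quadR a c ε k)) := by
    ring
  have e2 : (freqSin a k : ℂ) * (a * Real.cos k * quadR a c ε k - freqSin a k * c) =
      a * Real.cos k * (freqSin a k * quadR a c ε k) - freqSin a k ^ 2 * c := by ring
  rw [e1, e2, quadL, quadR, mul_div_cancel₀ _ hS0, mul_div_cancel₀ _ hS0, hS, cast_cos]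
  generalize exp (k * I) = z at *
  generalize exp (-k * I) = y at *
  linear_combination (-y * a * (z + y) / 2) * h2 + (b * ε * c - a * ε) * hz - ε * h1 - c * h3

/-- The wave evolves by the free walk: the equation for the left moving component. -/
theorem waveL_succ (h : WallData a b c ε) (t : ℕ) (k : ℝ) :
    waveL a c ε (t + 1) k = exp (k * I) * (a * waveL a c ε t k - b * waveR a c ε t k) := by
  have h1 : ((t + 1 : ℕ) : ℝ) * freq a k = t * freq a k + freq a k := by push_cast; ring
  rw [waveL, waveL, waveR, h1, Real.cos_add, Real.sin_add, h.cos_freq, sin_freq]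
  simp only [Complex.ofReal_sub, Complex.ofReal_add, Complex.ofReal_mul]
  linear_combination -profile c k * (Real.cos (t * freq a k) * h.evolve_e_L k +
    Real.sin (t * freq a k) * h.evolve_d_L k)

/-- The wave evolves by the free walk: the equation for the right moving component. -/
theorem waveR_succ (h : WallData a b c ε) (t : ℕ) (k : ℝ) :
    waveR a c ε (t + 1) k = exp (-k * I) * (b * waveL a c ε t k + a * waveR a c ε t k) := by
  have h1 : ((t + 1 : ℕ) : ℝ) * freq a k = t * freq a k + freq a k := by push_cast; ring
  rw [waveR, waveL, waveR, h1, Real.cos_add, Real.sin_add, h.cos_freq, sin_freq]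
  simp only [Complex.ofReal_sub, Complex.ofReal_add, Complex.ofReal_mul]
  linear_combination -profile c k * (Real.cos (t * freq a k) * h.evolve_e_R k +
    Real.sin (t * freq a k) * h.evolve_d_R k)

theorem continuous_freqSin (a : ℝ) : Continuous (freqSin a) := by
  unfold freqSin
  fun_prop

theorem continuous_freq (a : ℝ) : Continuous (freq a) := by
  unfold freq
  exact Real.continuous_arccos.comp (by fun_prop)

theorem continuous_quadL (h : WallData a b c ε) : Continuous (quadL a c ε) := by
  unfold quadL
  refine Continuous.div (by fun_prop) ?_ h.freqSin_ne_zero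
  exact Complex.continuous_ofReal.comp (continuous_freqSin a)

theorem continuous_quadR (h : WallData a b c ε) : Continuous (quadR a c ε) := by
  unfold quadR
  refine Continuous.div (by fun_prop) ?_ h.freqSin_ne_zero
  exact Complex.continuous_ofReal.comp (continuous_freqSin a)

theorem continuous_waveL (h : WallData a b c ε) (t : ℕ) : Continuous (waveL a c ε t) := by
  have h1 := continuous_profile h.c_sq_ne_one
  have h2 := continuous_freq a
  have h3 := h.continuous_quadL
  unfold waveL
  fun_prop

theorem continuous_waveR (h : WallData a b c ε) (t : ℕ) : Continuous (waveR a c ε t) := by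
  have h1 := continuous_profile h.c_sq_ne_one
  have h2 := continuous_freq a
  have h3 := h.continuous_quadR
  unfold waveR
  fun_prop

theorem periodic_waveL (t : ℕ) : Function.Periodic (waveL a c ε t) (2 * Real.pi) := by
  intro k
  have h1 : exp (((k + 2 * Real.pi : ℝ) : ℂ) * I) = exp (k * I) := by
    rw [Complex.exp_eq_exp_iff_exists_int]
    exact ⟨1, by push_cast; ring⟩
  simp only [waveL, quadL, freq, freqSin, periodic_profile c k, Real.cos_add_two_pi, h1]

theorem periodic_waveR (t : ℕ) : Function.Periodic (waveR a c ε t) (2 * Real.pi) := by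
  intro k
  have h1 : exp (-((k + 2 * Real.pi : ℝ) : ℂ) * I) = exp (-k * I) := by
    rw [Complex.exp_eq_exp_iff_exists_int]
    exact ⟨-1, by push_cast; ring⟩
  simp only [waveR, quadR, freq, freqSin, periodic_profile c k, Real.cos_add_two_pi, h1]

/-- The combination `R - c L` is an odd function of the momentum. -/
theorem waveR_sub (h : WallData a b c ε) (t : ℕ) (k : ℝ) :
    waveR a c ε t k - c * waveL a c ε t k =
      ε * (exp (-k * I) - exp (k * I)) * (Real.sin (t * freq a k) / freqSin a k) := by
  have h1 := one_sub_mul_exp_ne_zero (sq_nonneg c) h.c_sq_ne_one k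
  have h2 : exp (2 * k * I) = exp (k * I) * exp (k * I) := by
    rw [← Complex.exp_add]; ring_nf
  have hS0 := h.freqSin_ne_zero k
  have hz := exp_mul_exp_neg k
  rw [h2] at h1
  have h3 : (1 - exp (k * I) * exp (k * I)) * (1 - ((c ^ 2 : ℝ) : ℂ) * (exp (k * I) * exp (k * I)))⁻¹ *
      (exp (-k * I) - c ^ 2 * exp (k * I)) = exp (-k * I) - exp (k * I) := by
    rw [mul_right_comm, ← div_eq_mul_inv, div_eq_iff h1]
    push_cast
    linear_combination (-exp (k * I) + c ^ 2 * exp (k * I)) * hz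
  rw [← h3, waveR, waveL, quadR, quadL, profile, geometricProfile, h2]
  generalize (1 - ((c ^ 2 : ℝ) : ℂ) * (exp (k * I) * exp (k * I)))⁻¹ = q
  field_simp
  ring

/-- The boundary condition `R_t(0) = c L_t(0)` holds at all times. -/
theorem amplitude_waveR_zero (h : WallData a b c ε) (t : ℕ) :
    amplitude (waveR a c ε t) 0 = c * amplitude (waveL a c ε t) 0 := by
  have hR := h.continuous_waveR t
  have hL := h.continuous_waveL t
  rw [← sub_eq_zero, sub_eq_add_neg, ← neg_mul, ← amplitude_const_mul,
    ← amplitude_add hR (by fun_prop)]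
  apply amplitude_zero_of_odd
  intro k
  simp only [neg_mul, ← sub_eq_add_neg, h.waveR_sub, freq, freqSin, Real.cos_neg]
  simp only [Complex.ofReal_neg, neg_mul, neg_neg]
  ring

theorem amplitude_waveL_succ (h : WallData a b c ε) (t : ℕ) (x : ℤ) :
    amplitude (waveL a c ε (t + 1)) x =
      a * amplitude (waveL a c ε t) (x + 1) - b * amplitude (waveR a c ε t) (x + 1) := by
  have hR := h.continuous_waveR t
  have hL := h.continuous_waveL t
  rw [sub_eq_add_neg, ← neg_mul, ← amplitude_const_mul, ← amplitude_const_mul,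
    ← amplitude_add (by fun_prop) (by fun_prop), ← amplitude_exp_mul]
  congr 1
  funext k
  rw [h.waveL_succ]
  push_cast
  rw [one_mul]
  ring

theorem amplitude_waveR_succ (h : WallData a b c ε) (t : ℕ) (x : ℤ) :
    amplitude (waveR a c ε (t + 1)) x =
      b * amplitude (waveL a c ε t) (x - 1) + a * amplitude (waveR a c ε t) (x - 1) := by
  have hR := h.continuous_waveR t
  have hL := h.continuous_waveL t
  rw [← amplitude_const_mul, ← amplitude_const_mul,
    ← amplitude_add (by fun_prop) (by fun_prop), sub_eq_add_neg, ← amplitude_exp_mul]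
  congr 1
  funext k
  rw [h.waveR_succ]
  push_cast
  rw [neg_one_mul]

end WallData

/-! ### The reflected walk as a free walk plus bound states -/

theorem state_succ (κ : ℕ) (γ : ℝ) (t : ℕ) :
    state κ γ (t + 1) = shift (coin κ γ (state κ γ t)) :=
  Function.iterate_succ_apply' _ _ _

theorem coin_apply_of_ne (κ : ℕ) (γ : ℝ) (ψ : State) {x : ℤ} (hx : x ≠ 0) :
    coin κ γ ψ x = ![a κ * ψ x 0 - ((1 - 2 / κ : ℝ) : ℂ) * ψ x 1,
      ((1 - 2 / κ : ℝ) : ℂ) * ψ x 0 + a κ * ψ x 1] := by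
  funext i
  fin_cases i
  · simp [coin, localCoin, hx, coinMatrix, Matrix.mulVec, dotProduct, Fin.sum_univ_two]
    ring
  · simp [coin, localCoin, hx, coinMatrix, Matrix.mulVec, dotProduct, Fin.sum_univ_two]

theorem coin_apply_zero (κ : ℕ) (γ : ℝ) (ψ : State) :
    coin κ γ ψ 0 = ![exp (γ * I) * ψ 0 1, exp (γ * I) * ψ 0 0] := by
  funext i
  fin_cases i <;>
    simp [coin, localCoin, flipMatrix, Matrix.mulVec, dotProduct, Fin.sum_univ_two]

/-- The `L` amplitudes at time `t` of the bound state part `β (1, c) ρ ^ n` of the walk;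
it is carried by the sites with the parity of `t`. -/
def boundPart (β ρ : ℝ) (t n : ℕ) : ℂ := if Even (t + n) then β * ρ ^ n else 0

theorem boundPart_succ (β ρ : ℝ) (t n : ℕ) :
    boundPart β ρ t (n + 1) = ρ * boundPart β ρ (t + 1) n := by
  have e : t + (n + 1) = t + 1 + n := by ring
  rw [boundPart, boundPart, e]
  split_ifs <;> ring

theorem boundPart_time (β ρ : ℝ) (t n : ℕ) : boundPart β ρ (t + 2) n = boundPart β ρ t n := by
  have e : Even (t + 2 + n) ↔ Even (t + n) := by
    rw [add_right_comm]; simp [Nat.even_add]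
  simp only [boundPart, e]

/-- On the half line the reflected walk is the sum of a free walk and a bound state part. -/
theorem state_eq {κ : ℕ} {γ c ε β ρ : ℝ} (h : WallData (a κ) (1 - 2 / κ) c ε)
    (hγ : exp (γ * I) = ε) (hρ : ρ * c = ε)
    (h0 : ∀ n : ℕ, amplitude (profile c) n = (if n = 0 then 1 else 0) - boundPart β ρ 0 n) (t : ℕ) :
    (∀ n : ℕ, state κ γ t n 0 = amplitude (waveL (a κ) c ε t) n + boundPart β ρ t n) ∧
    (∀ n : ℕ, state κ γ t ((n + 1 : ℕ) : ℤ) 1 = amplitude (waveR (a κ) c ε t) ((n + 1 : ℕ) : ℤ) +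
      c * boundPart β ρ t (n + 1)) ∧ state κ γ t 0 1 = 0 ∧ ∀ x < 0, state κ γ t x = 0 := by
  have hε : (ε : ℂ) ^ 2 = 1 := by exact_mod_cast h.eps_sq
  have hρ' : (ρ : ℂ) * c = ε := by exact_mod_cast hρ
  have hc : (c : ℂ) ≠ 0 := by exact_mod_cast h.c_ne_zero
  have hab : (a κ : ℂ) - ((1 - 2 / κ : ℝ) : ℂ) * c = ε * c := by exact_mod_cast h.a_sub
  have hba : ((1 - 2 / κ : ℝ) : ℂ) + a κ * c = ε := by exact_mod_cast h.b_add
  -- The amplitude `ε β ρ ^ n` sent to the right by the site `n` is `c β ρ ^ (n + 1)`, as `ρ c = ε`.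
  have hstep : ∀ s n, (ε : ℂ) * boundPart β ρ s n = c * boundPart β ρ (s + 1) (n + 1) := by
    intro s n
    rw [boundPart_succ, boundPart_time, ← hρ']
    ring
  induction t with
  | zero =>
    refine ⟨fun n => ?_, fun n => ?_, ?_, fun x hx => ?_⟩
    · rw [WallData.waveL_zero, h0]
      simp only [state, Function.iterate_zero, id, initial, Nat.cast_eq_zero]
      split_ifs <;> simp
    · rw [WallData.waveR_zero, amplitude_const_mul, h0]
      have e : ((n + 1 : ℕ) : ℤ) ≠ 0 := by positivity
      simp only [state, Function.iterate_zero, id, initial, if_neg e, Pi.zero_apply,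
        if_neg (Nat.succ_ne_zero n)]
      ring
    · simp [state, initial]
    · simp [state, initial, hx.ne]
  | succ t ih =>
    obtain ⟨hL, hR, hR0, hneg⟩ := ih
    rw [state_succ]
    refine ⟨fun n => ?_, fun n => ?_, ?_, fun x hx => ?_⟩
    · have e : (n : ℤ) + 1 ≠ 0 := by positivity
      have e2 : (n : ℤ) + 1 = ((n + 1 : ℕ) : ℤ) := by push_cast; rfl
      simp only [shift, Matrix.cons_val_zero]
      rw [coin_apply_of_ne _ _ _ e]
      simp only [Matrix.cons_val_zero]
      rw [h.amplitude_waveL_succ, e2, hL, hR]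
      have h1 : (ε : ℂ) * c * boundPart β ρ t (n + 1) = boundPart β ρ (t + 1) n := by
        rw [boundPart_succ]
        linear_combination (ε * boundPart β ρ (t + 1) n) * hρ' + boundPart β ρ (t + 1) n * hε
      linear_combination boundPart β ρ t (n + 1) * hab + h1
    · have e : ((n + 1 : ℕ) : ℤ) - 1 = n := by push_cast; ring
      simp only [shift, Matrix.cons_val_one]
      rw [h.amplitude_waveR_succ, e]
      rcases n with _ | n
      · have hLn := hL 0
        simp only [Nat.cast_zero] at hLn ⊢
        simp only [coin_apply_zero, Matrix.cons_val_one, Matrix.cons_val_fin_one, hγ,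
          h.amplitude_waveR_zero, hLn]
        linear_combination hstep t 0 - amplitude (waveL (a κ) c ε t) 0 * hba
      · have e0 : ((n + 1 : ℕ) : ℤ) ≠ 0 := by positivity
        rw [coin_apply_of_ne _ _ _ e0]
        simp only [Matrix.cons_val_one, Matrix.cons_val_fin_one]
        rw [hL, hR]
        linear_combination hstep t (n + 1) + boundPart β ρ t (n + 1) * hba
    · simp only [shift, Matrix.cons_val_one, Matrix.cons_val_fin_one]
      rw [coin_apply_of_ne _ _ _ (by norm_num), hneg _ (by norm_num)]
      simp
    · funext i
      have h1 : coin κ γ (state κ γ t) (x - 1) = 0 := by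
        rw [coin_apply_of_ne _ _ _ (by omega), hneg _ (by omega)]
        simp
      have h2 : coin κ γ (state κ γ t) (x + 1) 0 = 0 := by
        by_cases hx1 : x + 1 = 0
        · rw [hx1, coin_apply_zero]
          simp [hR0]
        · rw [coin_apply_of_ne _ _ _ hx1, hneg _ (by omega)]
          simp
      fin_cases i <;> simp [shift, h1, h2]

/-! ### Convergence of characteristic functions -/

/-- The mass at site `x` of the free walk at time `t`. -/
def waveMass (a c ε : ℝ) (t : ℕ) (x : ℤ) : ℝ :=
  ‖amplitude (waveL a c ε t) x‖ ^ 2 + ‖amplitude (waveR a c ε t) x‖ ^ 2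

/-- The inner product of the momentum space waves at the momenta `k'` and `k`. -/
def waveInner (a c ε : ℝ) (t : ℕ) (k' k : ℝ) : ℂ :=
  conj (waveL a c ε t k') * waveL a c ε t k + conj (waveR a c ε t k') * waveR a c ε t k

theorem conj_exp_mul_I (k : ℝ) : conj (exp (k * I)) = exp (-k * I) := by
  rw [← Complex.exp_conj, map_mul, conj_I, Complex.conj_ofReal]
  ring_nf

theorem conj_exp_neg_mul_I (k : ℝ) : conj (exp (-k * I)) = exp (k * I) := by
  rw [← conj_exp_mul_I, Complex.conj_conj]

namespace WallData

variable {a b c ε : ℝ}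

/-- The vectors `e = (1, c)` and `d` are orthogonal. -/
theorem quad_orthogonal (h : WallData a b c ε) (k : ℝ) :
    quadL a c ε k + c * quadR a c ε k = 0 := by
  have h1 : (1 + (c : ℂ) ^ 2) * a = 2 * (ε * c) := by exact_mod_cast h.one_add_sq
  rw [quadL, quadR, ← mul_div_assoc, ← add_div, cast_cos]
  rw [div_eq_zero_iff]
  left
  linear_combination (-(exp (k * I) + exp (-k * I)) / 2) * h1

theorem conj_quad_orthogonal (h : WallData a b c ε) (k : ℝ) :
    conj (quadL a c ε k) + c * conj (quadR a c ε k) = 0 := by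
  have h1 := congrArg conj (h.quad_orthogonal k)
  simpa using h1

/-- The vectors `e = (1, c)` and `d` have the same length. -/
theorem quad_norm (h : WallData a b c ε) (k : ℝ) :
    conj (quadL a c ε k) * quadL a c ε k + conj (quadR a c ε k) * quadR a c ε k = 1 + c ^ 2 := by
  have h1 : (1 + (c : ℂ) ^ 2) * a = 2 * (ε * c) := by exact_mod_cast h.one_add_sq
  have h3 : (ε : ℂ) ^ 2 = 1 := by exact_mod_cast h.eps_sq
  have hS := h.freqSin_sq_complex k
  have hS0 := h.freqSin_ne_zero k
  have hz := exp_mul_exp_neg k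
  simp only [quadL, quadR, map_div₀, map_sub, map_mul, conj_exp_mul_I, conj_exp_neg_mul_I,
    Complex.conj_ofReal]
  rw [cast_cos] at hS ⊢
  generalize exp (k * I) = z at *
  generalize exp (-k * I) = y at *
  have h4 : (ε * c * y - a * ((z + y) / 2)) * (ε * c * z - a * ((z + y) / 2)) +
      (ε * z - c * (a * ((z + y) / 2))) * (ε * y - c * (a * ((z + y) / 2))) =
      (1 + c ^ 2) * (freqSin a k : ℂ) ^ 2 := by
    rw [hS]
    linear_combination (ε ^ 2 * (1 + c ^ 2)) * hz + (1 + c ^ 2) * h3 +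
      (a * (z + y) ^ 2 / 2) * h1
  rw [div_mul_div_comm, div_mul_div_comm, ← add_div, h4]
  field_simp

theorem waveInner_eq (h : WallData a b c ε) (t : ℕ) (k' k : ℝ) :
    waveInner a c ε t k' k = conj (profile c k') * profile c k *
      ((1 + c ^ 2) * Real.cos (t * (freq a k' - freq a k)) +
        Real.sin (t * freq a k') * Real.sin (t * freq a k) *
          (conj (quadL a c ε k') * quadL a c ε k + conj (quadR a c ε k') * quadR a c ε k -
            (1 + c ^ 2))) := by
  rw [mul_sub, Real.cos_sub, waveInner, waveL, waveL, waveR, waveR]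
  simp only [map_mul, map_add, Complex.conj_ofReal]
  push_cast
  linear_combination conj (profile c k') * profile c k *
    (cos (t * freq a k') * sin (t * freq a k) * h.quad_orthogonal k +
      sin (t * freq a k') * cos (t * freq a k) * h.conj_quad_orthogonal k')

/-- The free walk is unitary at each momentum. -/
theorem norm_sq_wave (h : WallData a b c ε) (t : ℕ) (k : ℝ) :
    ‖waveL a c ε t k‖ ^ 2 + ‖waveR a c ε t k‖ ^ 2 = (1 + c ^ 2) * ‖profile c k‖ ^ 2 := by
  have h1 := h.waveInner_eq t k k
  rw [h.quad_norm, waveInner] at h1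
  simp only [Complex.conj_mul', sub_self, mul_zero, Real.cos_zero, add_zero] at h1
  have h2 : ((‖waveL a c ε t k‖ ^ 2 + ‖waveR a c ε t k‖ ^ 2 : ℝ) : ℂ) =
      (((1 + c ^ 2) * ‖profile c k‖ ^ 2 : ℝ) : ℂ) := by
    push_cast at h1 ⊢
    rw [h1]
    ring
  exact_mod_cast h2

theorem norm_sq_wave_le (h : WallData a b c ε) (t : ℕ) (k : ℝ) :
    ‖waveL a c ε t k‖ ^ 2 + ‖waveR a c ε t k‖ ^ 2 ≤
      (1 + c ^ 2) * (2 * |1 - c ^ 2|⁻¹) ^ 2 := by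
  rw [h.norm_sq_wave]
  have := norm_profile_le h.c_sq_ne_one k
  gcongr

theorem norm_waveInner_le (h : WallData a b c ε) (t : ℕ) (k' k : ℝ) :
    ‖waveInner a c ε t k' k‖ ≤ (1 + c ^ 2) * (2 * |1 - c ^ 2|⁻¹) ^ 2 := by
  have h1 := h.norm_sq_wave_le t k
  have h2 := h.norm_sq_wave_le t k'
  refine (norm_add_le _ _).trans ?_
  rw [norm_mul, norm_mul, RCLike.norm_conj, RCLike.norm_conj]
  nlinarith [sq_nonneg (‖waveL a c ε t k'‖ - ‖waveL a c ε t k‖),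
    sq_nonneg (‖waveR a c ε t k'‖ - ‖waveR a c ε t k‖)]

theorem continuous_waveInner (h : WallData a b c ε) (t : ℕ) (η : ℝ) :
    Continuous fun k => waveInner a c ε t (k + η) k := by
  have h1 := h.continuous_waveL t
  have h2 := h.continuous_waveR t
  have h3 := Complex.continuous_conj
  unfold waveInner
  fun_prop

/-- The characteristic function of the mass distribution of the free walk. -/
theorem hasSum_exp_mul_waveMass (h : WallData a b c ε) (t : ℕ) (η : ℝ) :
    HasSum (fun x : ℤ => exp (x * η * I) * waveMass a c ε t x)
      ((2 * (Real.pi : ℂ))⁻¹ * ∫ k in (-Real.pi)..Real.pi, waveInner a c ε t (k + η) k) := by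
  have hL := h.continuous_waveL t
  have hR := h.continuous_waveR t
  have hconj := Complex.continuous_conj
  have key : ∀ F : ℝ → ℂ, Function.Periodic F (2 * Real.pi) → ∀ x : ℤ,
      conj (amplitude (fun k => F (k + η)) x) * amplitude F x =
        exp (x * η * I) * (‖amplitude F x‖ ^ 2 : ℝ) := by
    intro F hF x
    have e : conj (exp (-(x * η * I))) = exp (x * η * I) := by
      rw [← Complex.exp_conj]
      simp
    rw [amplitude_translate hF, map_mul, mul_assoc, Complex.conj_mul', e]
    push_cast
    rfl
  have h1 := (hasSum_conj_amplitude_mul (F := fun k => waveL a c ε t (k + η)) (by fun_prop) hL).add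
    (hasSum_conj_amplitude_mul (F := fun k => waveR a c ε t (k + η)) (by fun_prop) hR)
  rw [← mul_add, ← intervalIntegral.integral_add] at h1
  · refine h1.congr_fun fun x => ?_
    rw [key _ (periodic_waveL t), key _ (periodic_waveR t), waveMass]
    push_cast
    ring
  · apply Continuous.intervalIntegrable
    fun_prop
  · apply Continuous.intervalIntegrable
    fun_prop

theorem hasDerivAt_freq (h : WallData a b c ε) (k : ℝ) :
    HasDerivAt (freq a) (velocity a k) k := by
  have h1 := abs_lt.mp (h.abs_lt_one k)
  have h2 := (Real.hasDerivAt_arccos h1.1.ne' h1.2.ne).comp k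
    ((Real.hasDerivAt_cos k).const_mul a)
  have h3 : velocity a k = -(1 / Real.sqrt (1 - (a * Real.cos k) ^ 2)) * (a * -Real.sin k) := by
    rw [velocity, freqSin]
    ring
  rw [h3]
  exact h2

theorem continuous_velocity (h : WallData a b c ε) : Continuous (velocity a) := by
  unfold velocity
  exact Continuous.div (by fun_prop) (continuous_freqSin a) fun k => (h.freqSin_pos k).ne'

theorem tendsto_mul_freq_sub (h : WallData a b c ε) (ξ k : ℝ) :
    Tendsto (fun t : ℕ => (t : ℝ) * (freq a (k + ξ / t) - freq a k)) atTop
      (𝓝 (ξ * velocity a k)) := by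
  have h1 : HasDerivAt (fun s : ℝ => freq a (k + ξ * s)) (velocity a k * ξ) 0 := by
    have h2 : HasDerivAt (fun s : ℝ => k + ξ * s) ξ 0 := by
      simpa using ((hasDerivAt_id (0 : ℝ)).const_mul ξ).const_add k
    have h3 : HasDerivAt (freq a) (velocity a k) (k + ξ * 0) := by
      simpa using h.hasDerivAt_freq k
    exact HasDerivAt.comp (h₂ := freq a) (0 : ℝ) h3 h2
  have h4 := h1.tendsto_slope_zero
  have h5 : Tendsto (fun t : ℕ => (t : ℝ)⁻¹) atTop (𝓝[≠] 0) := by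
    refine tendsto_nhdsWithin_iff.mpr ⟨tendsto_inv_atTop_nhds_zero_nat, ?_⟩
    filter_upwards [eventually_gt_atTop 0] with t ht
    have : (t : ℝ) ≠ 0 := by positivity
    simpa using this
  have h6 := h4.comp h5
  rw [mul_comm]
  refine h6.congr fun t => ?_
  simp [div_eq_mul_inv]

theorem tendsto_waveInner (h : WallData a b c ε) (ξ k : ℝ) :
    Tendsto (fun t : ℕ => waveInner a c ε t (k + ξ / t) k) atTop
      (𝓝 (((1 + c ^ 2) * ‖profile c k‖ ^ 2 * Real.cos (ξ * velocity a k) : ℝ) : ℂ)) := by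
  have hk : Tendsto (fun t : ℕ => k + ξ / t) atTop (𝓝 k) := by
    have := (tendsto_const_div_atTop_nhds_zero_nat ξ).const_add k
    rwa [add_zero] at this
  have hconj := Complex.continuous_conj
  have hp := ((hconj.comp (continuous_profile h.c_sq_ne_one)).tendsto k).comp hk
  have hdL := ((hconj.comp h.continuous_quadL).tendsto k).comp hk
  have hdR := ((hconj.comp h.continuous_quadR).tendsto k).comp hk
  have hcos : Tendsto (fun t : ℕ => (Real.cos (t * (freq a (k + ξ / t) - freq a k)) : ℂ)) atTop
      (𝓝 (Real.cos (ξ * velocity a k) : ℂ)) :=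
    (Complex.continuous_ofReal.tendsto _).comp
      ((Real.continuous_cos.tendsto _).comp (h.tendsto_mul_freq_sub ξ k))
  have hD : Tendsto (fun t : ℕ => conj (quadL a c ε (k + ξ / t)) * quadL a c ε k +
      conj (quadR a c ε (k + ξ / t)) * quadR a c ε k - (1 + c ^ 2)) atTop (𝓝 0) := by
    have := ((hdL.mul_const (quadL a c ε k)).add (hdR.mul_const (quadR a c ε k))).sub_const
      (1 + (c : ℂ) ^ 2)
    simp only [Function.comp, h.quad_norm, sub_self] at this
    exact this
  have hsin : Tendsto (fun t : ℕ => (Real.sin (t * freq a (k + ξ / t)) : ℂ) *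
      Real.sin (t * freq a k) * (conj (quadL a c ε (k + ξ / t)) * quadL a c ε k +
      conj (quadR a c ε (k + ξ / t)) * quadR a c ε k - (1 + c ^ 2))) atTop (𝓝 0) := by
    refine squeeze_zero_norm (fun t => ?_) (tendsto_zero_iff_norm_tendsto_zero.mp hD)
    rw [norm_mul, norm_mul, Complex.norm_real, Complex.norm_real, Real.norm_eq_abs,
      Real.norm_eq_abs]
    refine mul_le_of_le_one_left (norm_nonneg _) ?_
    exact mul_le_one₀ (Real.abs_sin_le_one _) (abs_nonneg _) (Real.abs_sin_le_one _)
  have hall := (hp.mul_const (profile c k)).mul ((hcos.const_mul (1 + (c : ℂ) ^ 2)).add hsin)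
  simp only [Function.comp, ← h.waveInner_eq] at hall
  convert hall using 2
  rw [Complex.conj_mul']
  push_cast
  ring

theorem tendsto_tsum_waveMass (h : WallData a b c ε) (ξ : ℝ) :
    Tendsto (fun t : ℕ => ∑' x : ℤ, exp (x * (ξ / t : ℝ) * I) * waveMass a c ε t x) atTop
      (𝓝 ((2 * (Real.pi : ℂ))⁻¹ * ∫ k in (-Real.pi)..Real.pi,
        (((1 + c ^ 2) * ‖profile c k‖ ^ 2 * Real.cos (ξ * velocity a k) : ℝ) : ℂ))) := by
  simp only [fun t : ℕ => (h.hasSum_exp_mul_waveMass t (ξ / t)).tsum_eq]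
  refine Tendsto.const_mul _ ?_
  refine intervalIntegral.tendsto_integral_filter_of_dominated_convergence
    (fun _ => (1 + c ^ 2) * (2 * |1 - c ^ 2|⁻¹) ^ 2) ?_ ?_ ?_ ?_
  · exact Eventually.of_forall fun t => (h.continuous_waveInner t _).aestronglyMeasurable
  · exact Eventually.of_forall fun t => ae_of_all _ fun k _ => h.norm_waveInner_le t _ k
  · exact intervalIntegrable_const
  · exact ae_of_all _ fun k _ => h.tendsto_waveInner ξ k

theorem norm_one_sub_sq (r k : ℝ) :
    ‖1 - r * exp (2 * k * I)‖ ^ 2 = (1 - r) ^ 2 + 4 * r * Real.sin k ^ 2 := by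
  have e : exp (2 * k * I) = (Real.cos (2 * k) : ℝ) + (Real.sin (2 * k) : ℝ) * I := by
    rw [Complex.exp_mul_I]
    push_cast
    rfl
  rw [e, ← Complex.normSq_eq_norm_sq, Complex.normSq_apply]
  simp only [Complex.sub_re, Complex.sub_im, Complex.mul_re, Complex.mul_im, Complex.add_re,
    Complex.add_im, Complex.ofReal_re, Complex.ofReal_im, Complex.one_re, Complex.one_im,
    Complex.I_re, Complex.I_im]
  have h1 := Real.sin_sq_add_cos_sq (2 * k)
  have h2 := Real.cos_two_mul k
  have h3 := Real.sin_sq_add_cos_sq k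
  linear_combination r ^ 2 * h1 - 2 * r * h2 - 4 * r * h3

/-- The squared length of the initial wave at momentum `k` is proportional to the squared group
velocity. -/
theorem norm_sq_profile (h : WallData a b c ε) (k : ℝ) :
    (1 + c ^ 2) * ‖profile c k‖ ^ 2 = 2 / (1 - ε * b) * velocity a k ^ 2 := by
  have h1 := norm_one_sub_sq 1 k
  have h2 := norm_one_sub_sq (c ^ 2) k
  have h3 : (1 + c ^ 2) * a ^ 2 = 2 * (1 - ε * b) := by
    linear_combination a * h.one_add_sq + 2 * ε * h.a_mul_c + 2 * h.eps_sq
  have h4 : 4 * c ^ 2 = (1 + c ^ 2) ^ 2 * a ^ 2 := by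
    linear_combination (-(1 + c ^ 2) * a - 2 * (ε * c)) * h.one_add_sq - 4 * c ^ 2 * h.eps_sq
  have h5 : (1 - c ^ 2) ^ 2 + 4 * c ^ 2 * Real.sin k ^ 2 = (1 + c ^ 2) ^ 2 * freqSin a k ^ 2 := by
    rw [h.freqSin_sq]
    have := Real.sin_sq_add_cos_sq k
    linear_combination (Real.sin k ^ 2 - 1) * h4 + (1 + c ^ 2) ^ 2 * a ^ 2 * this
  have hS := h.freqSin_pos k
  have hc : 0 < 1 + c ^ 2 := by positivity
  have hε : 0 < 1 - ε * b := by
    have : 0 < (1 + c ^ 2) * a ^ 2 := by have := h.a_pos; positivity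
    linarith
  rw [profile, geometricProfile, norm_mul, norm_inv, mul_pow, inv_pow, h2, h5, velocity]
  rw [Complex.ofReal_one, one_mul] at h1
  rw [h1]
  field_simp
  linear_combination (-2 * Real.sin k ^ 2) * h3

end WallData

/-! ### The limiting velocity law -/

namespace WallData

variable {a b c ε : ℝ}

theorem velocity_sq (h : WallData a b c ε) (k : ℝ) :
    velocity a k ^ 2 = 1 - b ^ 2 / (Real.sin k ^ 2 + b ^ 2 * Real.cos k ^ 2) := by
  have h1 : freqSin a k ^ 2 = Real.sin k ^ 2 + b ^ 2 * Real.cos k ^ 2 := by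
    rw [h.freqSin_sq]
    linear_combination -Real.cos k ^ 2 * h.sq_add_sq - Real.sin_sq_add_cos_sq k
  have h2 := (pow_pos (h.freqSin_pos k) 2).ne'
  rw [velocity, div_pow, h1]
  rw [h1] at h2
  field_simp
  linear_combination Real.sin k ^ 2 * h.sq_add_sq - b ^ 2 * Real.sin_sq_add_cos_sq k

theorem hasDerivAt_velocity_sq_primitive (h : WallData a b c ε) (k : ℝ) :
    HasDerivAt (fun k => k - b * (k + Real.arctan ((1 - b) * (Real.sin k * Real.cos k) /
      (b * Real.cos k ^ 2 + Real.sin k ^ 2)))) (velocity a k ^ 2) k := by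
  have hb := h.b_pos
  have hsc := Real.sin_sq_add_cos_sq k
  have hD : 0 < b * Real.cos k ^ 2 + Real.sin k ^ 2 := by
    by_cases hs : Real.sin k = 0
    · have hc : Real.cos k ^ 2 = 1 := by rw [hs] at hsc; linarith
      rw [hs, hc]; linarith
    · positivity
  have hE : 0 < Real.sin k ^ 2 + b ^ 2 * Real.cos k ^ 2 := by
    by_cases hs : Real.sin k = 0
    · have hc : Real.cos k ^ 2 = 1 := by rw [hs] at hsc; linarith
      rw [hs, hc]; nlinarith
    · positivity
  have hN := ((Real.hasDerivAt_sin k).mul (Real.hasDerivAt_cos k)).const_mul (1 - b)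
  have hD' := (((Real.hasDerivAt_cos k).pow 2).const_mul b).add ((Real.hasDerivAt_sin k).pow 2)
  have h1 := (hasDerivAt_id k).sub
    (((hasDerivAt_id k).add (hN.div hD' hD.ne').arctan).const_mul b)
  refine h1.congr_deriv ?_
  rw [h.velocity_sq]
  simp only [Pi.mul_apply, Pi.add_apply, Pi.pow_apply, Pi.div_apply]
  generalize Real.sin k = s at *
  generalize Real.cos k = u at *
  have h2 : 1 + ((1 - b) * (s * u) / (b * u ^ 2 + s ^ 2)) ^ 2 =
      (s ^ 2 + b ^ 2 * u ^ 2) / (b * u ^ 2 + s ^ 2) ^ 2 := by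
    field_simp
    linear_combination (s ^ 2 + b ^ 2 * u ^ 2) * hsc
  rw [h2]
  field_simp
  push_cast
  linear_combination -b * ((1 - b) * (b * u ^ 2 - s ^ 2) + b) * hsc

theorem continuous_velocity_sq (h : WallData a b c ε) : Continuous fun k => velocity a k ^ 2 :=
  h.continuous_velocity.pow 2

theorem integral_velocity_sq (h : WallData a b c ε) :
    ∫ k in (-Real.pi)..Real.pi, velocity a k ^ 2 = 2 * Real.pi * (1 - b) := by
  rw [intervalIntegral.integral_eq_sub_of_hasDerivAt
    (fun k _ => h.hasDerivAt_velocity_sq_primitive k)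
    (h.continuous_velocity_sq.intervalIntegrable _ _)]
  simp
  ring

theorem integral_velocity_sq_quarter (h : WallData a b c ε) :
    ∫ k in (0 : ℝ)..(Real.pi / 2), velocity a k ^ 2 = Real.pi / 2 * (1 - b) := by
  rw [intervalIntegral.integral_eq_sub_of_hasDerivAt
    (fun k _ => h.hasDerivAt_velocity_sq_primitive k)
    (h.continuous_velocity_sq.intervalIntegrable _ _)]
  simp
  ring

theorem velocity_neg (a k : ℝ) : velocity a (-k) = -velocity a k := by
  simp only [velocity, freqSin, Real.sin_neg, Real.cos_neg]
  ring

theorem velocity_pi_sub (a k : ℝ) : velocity a (Real.pi - k) = velocity a k := by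
  simp only [velocity, freqSin, Real.sin_pi_sub, Real.cos_pi_sub]
  ring_nf

end WallData

/-- The law of the velocity of a wave packet whose momentum has density proportional to the squared
velocity. -/
def velocityLaw (a b : ℝ) : Measure ℝ :=
  ((volume.restrict (Set.Ioc (-Real.pi) Real.pi)).withDensity fun k =>
    ENNReal.ofReal (velocity a k ^ 2 / (2 * Real.pi * (1 - b)))).map (velocity a)

namespace WallData

variable {a b c ε : ℝ}

theorem isProbabilityMeasure_velocityLaw (h : WallData a b c ε) :
    IsProbabilityMeasure (velocityLaw a b) := by
  have hv := h.continuous_velocity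
  have hb : 0 < 1 - b := by linarith [h.b_lt_one]
  have hp := Real.pi_pos
  have hprob : IsProbabilityMeasure ((volume.restrict (Set.Ioc (-Real.pi) Real.pi)).withDensity
      fun k => ENNReal.ofReal (velocity a k ^ 2 / (2 * Real.pi * (1 - b)))) := by
    constructor
    rw [withDensity_apply _ MeasurableSet.univ, Measure.restrict_univ,
      ← ofReal_integral_eq_lintegral_ofReal]
    · rw [← intervalIntegral.integral_of_le (by linarith), intervalIntegral.integral_div,
        h.integral_velocity_sq, div_self (by positivity), ENNReal.ofReal_one]
    · exact ((h.continuous_velocity_sq.div_const _).integrableOn_Icc).mono_set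
        Set.Ioc_subset_Icc_self
    · exact ae_of_all _ fun k => by positivity
  exact Measure.isProbabilityMeasure_map hv.measurable.aemeasurable

theorem integral_velocityLaw {E : Type*} [NormedAddCommGroup E] [NormedSpace ℝ E]
    (h : WallData a b c ε) {g : ℝ → E} (hg : Continuous g) :
    ∫ x, g x ∂velocityLaw a b = (2 * Real.pi * (1 - b))⁻¹ •
      ∫ k in (-Real.pi)..Real.pi, velocity a k ^ 2 • g (velocity a k) := by
  have hv := h.continuous_velocity
  have hb : 0 < 1 - b := by linarith [h.b_lt_one]
  have hp := Real.pi_pos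
  rw [velocityLaw, integral_map hv.measurable.aemeasurable hg.aestronglyMeasurable,
    integral_withDensity_eq_integral_toReal_smul (by fun_prop)
      (ae_of_all _ fun _ => ENNReal.ofReal_lt_top),
    ← intervalIntegral.integral_of_le (by linarith), ← intervalIntegral.integral_smul]
  refine intervalIntegral.integral_congr fun k _ => ?_
  rw [ENNReal.toReal_ofReal (by positivity), smul_smul]
  congr 1
  ring

theorem charFun_velocityLaw (h : WallData a b c ε) (ξ : ℝ) :
    charFun (velocityLaw a b) ξ = (2 * (Real.pi : ℂ) * (1 - b))⁻¹ *
      ∫ k in (-Real.pi)..Real.pi, ((velocity a k ^ 2 * Real.cos (ξ * velocity a k) : ℝ) : ℂ) := by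
  have hv := h.continuous_velocity
  rw [charFun_apply_real, h.integral_velocityLaw (by fun_prop), Complex.real_smul]
  congr 1
  · push_cast; rfl
  have h1 : ∀ k : ℝ, velocity a k ^ 2 • exp (ξ * velocity a k * I) =
      ((velocity a k ^ 2 * Real.cos (ξ * velocity a k) : ℝ) : ℂ) +
      ((velocity a k ^ 2 * Real.sin (ξ * velocity a k) : ℝ) : ℂ) * I := by
    intro k
    rw [Complex.exp_mul_I, Complex.real_smul]
    push_cast
    ring
  have h2 : ∫ k in (-Real.pi)..Real.pi,
      ((velocity a k ^ 2 * Real.sin (ξ * velocity a k) : ℝ) : ℂ) * I = 0 := by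
    have h3 := intervalIntegral.integral_comp_neg (a := -Real.pi) (b := Real.pi)
      fun k => ((velocity a k ^ 2 * Real.sin (ξ * velocity a k) : ℝ) : ℂ) * I
    simp only [velocity_neg, mul_neg, Real.sin_neg, neg_sq, neg_neg, Complex.ofReal_neg, neg_mul,
      intervalIntegral.integral_neg] at h3
    have h4 : 2 * ∫ k in (-Real.pi)..Real.pi,
      ((velocity a k ^ 2 * Real.sin (ξ * velocity a k) : ℝ) : ℂ) * I = 0 := by
      linear_combination -h3
    simpa using h4
  simp only [h1]
  rw [intervalIntegral.integral_add, h2, add_zero]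
  · apply Continuous.intervalIntegrable
    fun_prop
  · apply Continuous.intervalIntegrable
    fun_prop

theorem one_sub_eps_mul_pos (h : WallData a b c ε) : 0 < 1 - ε * b := by
  have h1 := h.b_lt_one
  have h2 := abs_le_one_iff_mul_self_le_one.mpr (by nlinarith [h.eps_sq] : ε * ε ≤ 1)
  nlinarith [abs_le.mp h2, h.b_pos]

/-- The total mass of the free walk. -/
def totalMass (b ε : ℝ) : ℝ := 2 * (1 - b) / (1 - ε * b)

theorem totalMass_pos (h : WallData a b c ε) : 0 < totalMass b ε := by
  have := h.b_lt_one
  exact div_pos (by linarith) h.one_sub_eps_mul_pos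

theorem waveMass_nonneg (t : ℕ) (x : ℤ) : 0 ≤ waveMass a c ε t x := by
  unfold waveMass
  positivity

theorem hasSum_waveMass (h : WallData a b c ε) (t : ℕ) :
    HasSum (waveMass a c ε t) (totalMass b ε) := by
  have h1 := h.hasSum_exp_mul_waveMass t 0
  have h2 : ∀ k, waveInner a c ε t (k + 0) k =
      ((2 / (1 - ε * b) * velocity a k ^ 2 : ℝ) : ℂ) := by
    intro k
    rw [← h.norm_sq_profile, ← h.norm_sq_wave t, waveInner, add_zero, Complex.conj_mul',
      Complex.conj_mul']
    push_cast
    rfl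
  have h3 : (2 * (Real.pi : ℂ))⁻¹ * ∫ k in (-Real.pi)..Real.pi, waveInner a c ε t (k + 0) k =
      (totalMass b ε : ℝ) := by
    simp only [h2]
    rw [intervalIntegral.integral_ofReal, intervalIntegral.integral_const_mul,
      h.integral_velocity_sq]
    have hp : (2 * Real.pi)⁻¹ * (2 / (1 - ε * b) * (2 * Real.pi * (1 - b))) = totalMass b ε := by
      have := h.one_sub_eps_mul_pos
      have := Real.pi_pos
      rw [totalMass]
      field_simp
    exact_mod_cast hp
  rw [h3] at h1
  simp only [Complex.ofReal_zero, mul_zero, zero_mul, Complex.exp_zero, one_mul] at h1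
  exact Complex.hasSum_ofReal.mp h1

end WallData

theorem integral_map_div_toMeasure {E : Type*} [NormedAddCommGroup E] [NormedSpace ℝ E]
    [CompleteSpace E] (p : PMF ℤ) (t : ℕ) {g : ℝ → E} (hg : Continuous g) {K : ℝ}
    (hK : ∀ x, ‖g x‖ ≤ K) :
    ∫ y, g y ∂(p.toMeasure.map fun x : ℤ => (x : ℝ) / t) =
      ∑' x : ℤ, (p x).toReal • g ((x : ℝ) / t) := by
  rw [integral_map (measurable_of_countable _).aemeasurable hg.aestronglyMeasurable]
  apply PMF.integral_eq_tsum
  refine Integrable.of_bound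
    (hg.stronglyMeasurable.comp_measurable (measurable_of_countable _)).aestronglyMeasurable K
    (ae_of_all _ fun x => hK _)

/-! ### Weak limit of the free walk -/

namespace WallData

variable {a b c ε : ℝ}

/-- The mass distribution of the free walk, normalized to a probability distribution. -/
def wavePMF (h : WallData a b c ε) (t : ℕ) : PMF ℤ :=
  ⟨fun x => ENNReal.ofReal (waveMass a c ε t x / totalMass b ε), by
    have h1 := (h.hasSum_waveMass t).div_const (totalMass b ε)
    rw [div_self h.totalMass_pos.ne'] at h1
    have h2 := ENNReal.ofReal_tsum_of_nonneg
      (fun x => div_nonneg (waveMass_nonneg t x) h.totalMass_pos.le) h1.summable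
    rw [h1.tsum_eq, ENNReal.ofReal_one] at h2
    rw [h2]
    exact ENNReal.summable.hasSum⟩

theorem toReal_wavePMF (h : WallData a b c ε) (t : ℕ) (x : ℤ) :
    (h.wavePMF t x).toReal = waveMass a c ε t x / totalMass b ε :=
  ENNReal.toReal_ofReal (div_nonneg (waveMass_nonneg t x) h.totalMass_pos.le)

/-- The distribution of the rescaled position of the free walk. -/
def rescaledWaveLaw (h : WallData a b c ε) (t : ℕ) : ProbabilityMeasure ℝ :=
  ⟨(h.wavePMF t).toMeasure.map (fun x : ℤ => (x : ℝ) / t),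
    Measure.isProbabilityMeasure_map (measurable_of_countable _).aemeasurable⟩

/-- The rescaled position of the free walk converges in distribution to the group velocity. -/
theorem tendsto_rescaledWaveLaw (h : WallData a b c ε) :
    Tendsto h.rescaledWaveLaw atTop
      (𝓝 (⟨velocityLaw a b, h.isProbabilityMeasure_velocityLaw⟩ : ProbabilityMeasure ℝ)) := by
  refine ProbabilityMeasure.tendsto_iff_tendsto_charFun.mpr fun ξ => ?_
  have h1 := (h.tendsto_tsum_waveMass ξ).const_mul ((totalMass b ε : ℂ)⁻¹)
  have h2 : ∀ t : ℕ, charFun (h.rescaledWaveLaw t : Measure ℝ) ξ = (totalMass b ε : ℂ)⁻¹ *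
      ∑' x : ℤ, exp (x * (ξ / t : ℝ) * I) * waveMass a c ε t x := by
    intro t
    rw [charFun_apply_real, rescaledWaveLaw, ProbabilityMeasure.coe_mk,
      integral_map_div_toMeasure _ _ (by fun_prop) (K := 1), ← tsum_mul_left]
    · refine tsum_congr fun x => ?_
      rw [h.toReal_wavePMF, Complex.real_smul]
      push_cast
      have e : (ξ : ℂ) * (x / t) * I = x * (ξ / t) * I := by ring
      rw [e]
      ring
    · intro x
      have := Complex.norm_exp_ofReal_mul_I (ξ * x)
      push_cast at this
      exact this.le
  simp only [h2]
  convert h1 using 2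
  simp only [ProbabilityMeasure.coe_mk]
  rw [h.charFun_velocityLaw]
  have h3 : ∀ k : ℝ, (((1 + c ^ 2) * ‖profile c k‖ ^ 2 * Real.cos (ξ * velocity a k) : ℝ) : ℂ) =
      (2 / (1 - ε * b) : ℝ) * ((velocity a k ^ 2 * Real.cos (ξ * velocity a k) : ℝ) : ℂ) := by
    intro k
    rw [h.norm_sq_profile]
    push_cast
    ring
  simp only [h3]
  rw [intervalIntegral.integral_const_mul, ← mul_assoc, ← mul_assoc]
  congr 1
  have hb : (1 - b : ℝ) ≠ 0 := by linarith [h.b_lt_one]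
  have hε := h.one_sub_eps_mul_pos.ne'
  have hp := Real.pi_ne_zero
  have e : (2 * Real.pi * (1 - b))⁻¹ =
      (totalMass b ε)⁻¹ * (2 * Real.pi)⁻¹ * (2 / (1 - ε * b)) := by
    rw [totalMass]
    generalize 1 - ε * b = q at *
    field_simp
  exact_mod_cast e

theorem tendsto_tsum_waveMass_mul (h : WallData a b c ε) {g : ℝ → ℝ} (hg : Continuous g) {K : ℝ}
    (hK : ∀ x, ‖g x‖ ≤ K) :
    Tendsto (fun t : ℕ => ∑' x : ℤ, waveMass a c ε t x * g (x / t)) atTop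
      (𝓝 ((Real.pi * (1 - ε * b))⁻¹ *
        ∫ k in (-Real.pi)..Real.pi, velocity a k ^ 2 * g (velocity a k))) := by
  have h1 := (ProbabilityMeasure.tendsto_iff_forall_integral_tendsto.mp h.tendsto_rescaledWaveLaw
    (BoundedContinuousFunction.ofNormedAddCommGroup g hg K hK)).const_mul (totalMass b ε)
  simp only [BoundedContinuousFunction.coe_ofNormedAddCommGroup, ProbabilityMeasure.coe_mk,
    rescaledWaveLaw, integral_map_div_toMeasure _ _ hg hK, h.toReal_wavePMF,
    h.integral_velocityLaw hg, smul_eq_mul, ← tsum_mul_left] at h1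
  have hM := h.totalMass_pos.ne'
  convert h1 using 2
  · refine tsum_congr fun x => ?_
    field_simp
  · rw [← mul_assoc]
    congr 1
    have hb : (1 - b : ℝ) ≠ 0 := by linarith [h.b_lt_one]
    have hε := h.one_sub_eps_mul_pos.ne'
    have hp := Real.pi_ne_zero
    rw [totalMass]
    field_simp

theorem velocity_nonneg (h : WallData a b c ε) {k : ℝ} (h0 : 0 ≤ k) (h1 : k ≤ Real.pi) :
    0 ≤ velocity a k :=
  div_nonneg (mul_nonneg h.a_pos.le (Real.sin_nonneg_of_nonneg_of_le_pi h0 h1))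
    (h.freqSin_pos k).le

/-- Only the momenta with positive velocity contribute to functions supported on the right half
line, and `k` and `π - k` have the same velocity. -/
theorem integral_velocity_of_eq_zero (h : WallData a b c ε) {g : ℝ → ℝ} (hg : Continuous g)
    (h0 : ∀ x ≤ 0, g x = 0) :
    ∫ k in (-Real.pi)..Real.pi, velocity a k ^ 2 * g (velocity a k) =
      2 * ∫ k in (0 : ℝ)..(Real.pi / 2), velocity a k ^ 2 * g (velocity a k) := by
  have hv := h.continuous_velocity
  have hp := Real.pi_pos
  have hc : Continuous fun k => velocity a k ^ 2 * g (velocity a k) := by fun_prop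
  have hi := fun x y : ℝ => hc.intervalIntegrable (μ := volume) x y
  rw [← intervalIntegral.integral_add_adjacent_intervals (hi _ 0) (hi 0 _),
    ← intervalIntegral.integral_add_adjacent_intervals (hi 0 (Real.pi / 2)) (hi (Real.pi / 2) _)]
  have h1 : ∫ k in (-Real.pi)..0, velocity a k ^ 2 * g (velocity a k) = 0 := by
    rw [intervalIntegral.integral_congr (g := fun _ => 0)]
    · simp
    · intro k hk
      rw [Set.uIcc_of_le (by linarith)] at hk
      have h2 := h.velocity_nonneg (k := -k) (by linarith [hk.2]) (by linarith [hk.1])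
      rw [velocity_neg] at h2
      simp [h0 (velocity a k) (by linarith)]
  have h2 := intervalIntegral.integral_comp_sub_left (a := 0) (b := Real.pi / 2)
    (fun k => velocity a k ^ 2 * g (velocity a k)) Real.pi
  simp only [velocity_pi_sub, sub_zero] at h2
  have e : Real.pi - Real.pi / 2 = Real.pi / 2 := by ring
  rw [e] at h2
  rw [h1, ← h2]
  ring

end WallData

/-! ### The density of the limit law -/

theorem a_pos {κ : ℕ} (hκ : 3 ≤ κ) : 0 < a κ := by
  have h1 : (3 : ℝ) ≤ κ := by exact_mod_cast hκ
  have h2 : 0 < Real.sqrt ((κ : ℝ) - 1) := Real.sqrt_pos.mpr (by linarith)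
  rw [a]
  positivity

theorem one_sub_two_div_pos {κ : ℕ} (hκ : 3 ≤ κ) : 0 < 1 - 2 / (κ : ℝ) := by
  have h1 : (3 : ℝ) ≤ κ := by exact_mod_cast hκ
  rw [sub_pos, div_lt_one (by linarith)]
  linarith

theorem a_lt_one {κ : ℕ} (hκ : 3 ≤ κ) : a κ < 1 := by
  nlinarith [a_sq κ, a_pos hκ, one_sub_two_div_pos hκ]

namespace WallData

variable {a b c ε : ℝ}

theorem one_sub_velocity_sq (h : WallData a b c ε) (k : ℝ) :
    1 - velocity a k ^ 2 = b ^ 2 / freqSin a k ^ 2 := by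
  have h2 := (pow_pos (h.freqSin_pos k) 2).ne'
  rw [velocity, div_pow, eq_div_iff h2, sub_mul, div_mul_cancel₀ _ h2, h.freqSin_sq]
  linear_combination -h.sq_add_sq - a ^ 2 * Real.sin_sq_add_cos_sq k

theorem sq_sub_velocity_sq (h : WallData a b c ε) (k : ℝ) :
    a ^ 2 - velocity a k ^ 2 = (a * Real.cos k * b / freqSin a k) ^ 2 := by
  have h2 := (pow_pos (h.freqSin_pos k) 2).ne'
  rw [velocity, div_pow, div_pow, eq_div_iff h2, sub_mul, div_mul_cancel₀ _ h2, h.freqSin_sq]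
  linear_combination -a ^ 2 * Real.cos k ^ 2 * h.sq_add_sq - a ^ 2 * Real.sin_sq_add_cos_sq k

theorem hasDerivAt_velocity (h : WallData a b c ε) (k : ℝ) :
    HasDerivAt (velocity a) (a * Real.cos k * b ^ 2 / freqSin a k ^ 3) k := by
  have hS := h.freqSin_pos k
  have hpos : 1 - (a * Real.cos k) ^ 2 ≠ 0 := by
    rw [← h.freqSin_sq]
    positivity
  have h1 : HasDerivAt (freqSin a) (a ^ 2 * Real.sin k * Real.cos k / freqSin a k) k := by
    have h2 := ((((Real.hasDerivAt_cos k).const_mul a).pow 2).const_sub 1).sqrt hpos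
    refine h2.congr_deriv ?_
    change _ / (2 * freqSin a k) = _
    field_simp
    push_cast
    ring
  have h3 := ((Real.hasDerivAt_sin k).const_mul a).div h1 hS.ne'
  refine h3.congr_deriv ?_
  field_simp
  have h4 := h.freqSin_sq k
  linear_combination a * Real.cos k *
    (h4 - a ^ 2 * Real.sin_sq_add_cos_sq k - h.sq_add_sq)

theorem strictMonoOn_velocity (h : WallData a b c ε) :
    StrictMonoOn (velocity a) (Set.Icc 0 (Real.pi / 2)) := by
  refine strictMonoOn_of_deriv_pos (convex_Icc _ _) h.continuous_velocity.continuousOn fun k hk => ?_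
  rw [interior_Icc] at hk
  rw [(h.hasDerivAt_velocity k).deriv]
  have h1 := Real.cos_pos_of_mem_Ioo ⟨by linarith [hk.1, Real.pi_pos], hk.2⟩
  have h2 := h.freqSin_pos k
  have h3 := h.a_pos
  have h4 := h.b_pos
  positivity

theorem velocity_zero (a : ℝ) : velocity a 0 = 0 := by simp [velocity]

theorem velocity_pi_div_two (a : ℝ) : velocity a (Real.pi / 2) = a := by
  simp [velocity, freqSin]

theorem image_velocity (h : WallData a b c ε) :
    velocity a '' Set.Ioo 0 (Real.pi / 2) = Set.Ioo 0 a := by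
  have hp := Real.pi_pos
  have hm := h.strictMonoOn_velocity
  apply Set.Subset.antisymm
  · rintro _ ⟨k, hk, rfl⟩
    have h1 := hm (Set.left_mem_Icc.mpr (by linarith)) ⟨hk.1.le, hk.2.le⟩ hk.1
    have h2 := hm ⟨hk.1.le, hk.2.le⟩ (Set.right_mem_Icc.mpr (by linarith)) hk.2
    rw [velocity_zero] at h1
    rw [velocity_pi_div_two] at h2
    exact ⟨h1, h2⟩
  · have h1 := intermediate_value_Ioo (by linarith : (0 : ℝ) ≤ Real.pi / 2)
      h.continuous_velocity.continuousOn
    rwa [velocity_zero, velocity_pi_div_two] at h1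

end WallData

theorem f_nonneg {κ : ℕ} (hκ : 3 ≤ κ) (x : ℝ) : 0 ≤ f κ x := by
  have h1 : (3 : ℝ) ≤ κ := by exact_mod_cast hκ
  by_cases hx : x ∈ Set.Ico 0 (a κ)
  · have h2 : 0 ≤ 1 - x ^ 2 := by nlinarith [hx.1, hx.2, a_lt_one hκ]
    have h3 : (0 : ℝ) ≤ κ - 2 := by linarith
    rw [f, Set.indicator_of_mem hx, Pi.one_apply]
    have := Real.pi_pos
    positivity
  · simp [f, Set.indicator_of_notMem hx]

theorem f_eq_zero {κ : ℕ} {x : ℝ} (hx : x ∉ Set.Ioo 0 (a κ)) : f κ x = 0 := by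
  by_cases hx0 : x = 0
  · simp [f, hx0]
  · have : x ∉ Set.Ico 0 (a κ) := fun h => hx ⟨lt_of_le_of_ne h.1 (Ne.symm hx0), h.2⟩
    simp [f, Set.indicator_of_notMem this]

theorem measurable_f (κ : ℕ) : Measurable (f κ) := by
  have h1 : Measurable ((Set.Ico 0 (a κ)).indicator (1 : ℝ → ℝ)) :=
    measurable_one.indicator measurableSet_Ico
  unfold f
  fun_prop

/-- The substitution `x = velocity k` turns the density `f κ` into `κ / π` times the squared
velocity. -/
theorem abs_deriv_mul_f {κ : ℕ} (hκ : 3 ≤ κ) {c ε : ℝ} (h : WallData (a κ) (1 - 2 / κ) c ε) {k : ℝ}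
    (hk : k ∈ Set.Ioo 0 (Real.pi / 2)) :
    |a κ * Real.cos k * (1 - 2 / κ) ^ 2 / freqSin (a κ) k ^ 3| * f κ (velocity (a κ) k) =
      κ / Real.pi * velocity (a κ) k ^ 2 := by
  have h1 : (3 : ℝ) ≤ κ := by exact_mod_cast hκ
  have hcos := Real.cos_pos_of_mem_Ioo ⟨by linarith [hk.1, Real.pi_pos], hk.2⟩
  have hS := h.freqSin_pos k
  have ha := h.a_pos
  have hb := h.b_pos
  have hp := Real.pi_pos
  have hmem : velocity (a κ) k ∈ Set.Ioo 0 (a κ) := by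
    rw [← h.image_velocity]
    exact ⟨k, hk, rfl⟩
  have hmem' : velocity (a κ) k ∈ Set.Ico 0 (a κ) := ⟨hmem.1.le, hmem.2⟩
  have hκb : (κ : ℝ) - 2 = κ * (1 - 2 / κ) := by field_simp
  rw [f, Set.indicator_of_mem hmem', h.one_sub_velocity_sq, h.sq_sub_velocity_sq,
    Real.sqrt_sq (by positivity), abs_of_pos (by positivity), hκb, Pi.one_apply]
  generalize 1 - 2 / (κ : ℝ) = b at *
  field_simp

theorem integral_densityMeasure {κ : ℕ} (hκ : 3 ≤ κ) {c ε : ℝ}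
    (h : WallData (a κ) (1 - 2 / κ) c ε) (g : ℝ → ℝ) :
    ∫ x, g x ∂densityMeasure κ = κ / Real.pi *
      ∫ k in (0 : ℝ)..(Real.pi / 2), velocity (a κ) k ^ 2 * g (velocity (a κ) k) := by
  have hinj := h.strictMonoOn_velocity.injOn.mono Set.Ioo_subset_Icc_self
  rw [densityMeasure, integral_withDensity_eq_integral_toReal_smul
    (measurable_f κ).ennreal_ofReal (ae_of_all _ fun _ => ENNReal.ofReal_lt_top)]
  simp only [ENNReal.toReal_ofReal (f_nonneg hκ _)]
  rw [← setIntegral_eq_integral_of_forall_compl_eq_zero (s := Set.Ioo 0 (a κ))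
    (fun x hx => by rw [f_eq_zero hx, zero_smul]), ← h.image_velocity,
    integral_image_eq_integral_abs_deriv_smul measurableSet_Ioo
      (fun k _ => (h.hasDerivAt_velocity k).hasDerivWithinAt) hinj,
    ← intervalIntegral.integral_const_mul,
    intervalIntegral.integral_of_le (by linarith [Real.pi_pos]), integral_Ioc_eq_integral_Ioo]
  refine setIntegral_congr_fun measurableSet_Ioo fun k hk => ?_
  simp only [smul_eq_mul]
  rw [← mul_assoc, abs_deriv_mul_f hκ h hk, mul_assoc]

theorem isProbabilityMeasure_densityMeasure {κ : ℕ} (hκ : 3 ≤ κ) {c ε : ℝ}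
    (h : WallData (a κ) (1 - 2 / κ) c ε) : IsProbabilityMeasure (densityMeasure κ) := by
  have hκ' : (κ : ℝ) ≠ 0 := by positivity
  have hp := Real.pi_ne_zero
  have h1 := integral_densityMeasure hκ h fun _ => 1
  simp only [mul_one, h.integral_velocity_sq_quarter, integral_const, smul_eq_mul] at h1
  have h2 : (κ : ℝ) / Real.pi * (Real.pi / 2 * (1 - (1 - 2 / κ))) = 1 := by
    field_simp
    ring
  rw [h2, measureReal_def] at h1
  constructor
  rw [← ENNReal.toReal_eq_one_iff]
  exact h1

theorem f_eq_konnoDensity {κ : ℕ} (hκ : 3 ≤ κ) (x : ℝ) :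
    f κ x = κ * x ^ 2 * konnoDensity x (a κ) * (Set.Ici (0 : ℝ)).indicator 1 x := by
  have ha := a_pos hκ
  by_cases hx : x ∈ Set.Ioo 0 (a κ)
  · have h1 : x ∈ Set.Ioo (-|a κ|) |a κ| := by
      rw [abs_of_pos ha]
      exact ⟨by linarith [hx.1], hx.2⟩
    have h2 : Real.sqrt (1 - a κ ^ 2) = 1 - 2 / (κ : ℝ) := by
      have h4 : 1 - a κ ^ 2 = (1 - 2 / (κ : ℝ)) ^ 2 := by linarith [a_sq κ]
      rw [h4, Real.sqrt_sq (one_sub_two_div_pos hκ).le]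
    have h5 : x ∈ Set.Ico 0 (a κ) := ⟨hx.1.le, hx.2⟩
    have h3 : (κ : ℝ) * (1 - 2 / κ) = κ - 2 := by
      have hκ' : (κ : ℝ) ≠ 0 := by positivity
      field_simp
    rw [f, konnoDensity, h2, Set.indicator_of_mem h1, Set.indicator_of_mem (Set.mem_Ici.mpr hx.1.le),
      Set.indicator_of_mem h5, ← h3]
    simp only [Pi.one_apply]
    ring
  · rw [f_eq_zero hx]
    rcases lt_trichotomy x 0 with h0 | h0 | h0
    · simp [Set.indicator_of_notMem (fun h : x ∈ Set.Ici (0 : ℝ) => absurd h0 (not_lt.mpr h))]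
    · simp [h0]
    · have h1 : x ∉ Set.Ioo (-|a κ|) |a κ| := by
        rw [abs_of_pos ha]
        exact fun h => hx ⟨h0, h.2⟩
      simp [konnoDensity, Set.indicator_of_notMem h1]

/-! ### Weak limit of the reflected walk -/

theorem hasSum_law (κ : ℕ) (γ : ℝ) (t : ℕ) : HasSum (fun x => (law κ γ t x).toReal) 1 := by
  have h1 := ENNReal.hasSum_toReal (f := law κ γ t) (by rw [PMF.tsum_coe]; exact ENNReal.one_ne_top)
  rwa [← ENNReal.tsum_toReal_eq (fun x => PMF.apply_ne_top _ x), PMF.tsum_coe,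
    ENNReal.toReal_one] at h1

theorem toReal_law (κ : ℕ) (γ : ℝ) (t : ℕ) (x : ℤ) :
    (law κ γ t x).toReal = ‖state κ γ t x 0‖ ^ 2 + ‖state κ γ t x 1‖ ^ 2 :=
  ENNReal.toReal_ofReal (by positivity)

theorem summable_mul_of_bounded {ι : Type*} {p g : ι → ℝ} (hp : Summable p) (h0 : ∀ i, 0 ≤ p i) {K : ℝ}
    (hK : ∀ i, |g i| ≤ K) : Summable fun i => p i * g i := by
  refine Summable.of_norm_bounded (hp.mul_right K) fun i => ?_
  rw [Real.norm_eq_abs, abs_mul, abs_of_nonneg (h0 i)]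
  exact mul_le_mul_of_nonneg_left (hK i) (h0 i)

theorem abs_norm_add_sq_sub_le (A B : ℂ) {M T : ℝ} (hA : ‖A‖ ≤ M) (hB : ‖B‖ ≤ T) :
    |‖A + B‖ ^ 2 - ‖A‖ ^ 2| ≤ ‖B‖ * (2 * M + T) := by
  have h1 := abs_norm_sub_norm_le (A + B) A
  rw [add_sub_cancel_left] at h1
  have h2 := norm_add_le A B
  have h3 : ‖A + B‖ ^ 2 - ‖A‖ ^ 2 = (‖A + B‖ - ‖A‖) * (‖A + B‖ + ‖A‖) := by ring
  rw [h3, abs_mul, abs_of_nonneg (by positivity : 0 ≤ ‖A + B‖ + ‖A‖)]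
  exact mul_le_mul h1 (by linarith) (by positivity) (norm_nonneg _)

theorem norm_boundPart_le (β ρ : ℝ) (t n : ℕ) : ‖boundPart β ρ t n‖ ≤ |β * ρ ^ n| := by
  unfold boundPart
  split_ifs
  · rw [← Complex.ofReal_pow, ← Complex.ofReal_mul, Complex.norm_real, Real.norm_eq_abs]
  · rw [norm_zero]
    exact abs_nonneg _

/-- The mass of the reflected walk differs from that of the free walk by a summable quantity,
uniformly in time. -/
theorem exists_abs_law_sub_le {κ : ℕ} {γ c ε β ρ : ℝ} (h : WallData (a κ) (1 - 2 / κ) c ε)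
    (hγ : exp (γ * I) = ε) (hρ : ρ * c = ε)
    (h0 : ∀ n : ℕ, amplitude (profile c) n = (if n = 0 then 1 else 0) - boundPart β ρ 0 n)
    (hs : Summable fun n : ℕ => |β * ρ ^ n|) :
    ∃ D, ∀ t n : ℕ, |(law κ γ t ((n + 1 : ℕ) : ℤ)).toReal -
      waveMass (a κ) c ε t ((n + 1 : ℕ) : ℤ)| ≤ D * |β * ρ ^ (n + 1)| := by
  set T := ∑' n : ℕ, |β * ρ ^ n| with hT
  set M := Real.sqrt (WallData.totalMass (1 - 2 / κ) ε) with hM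
  refine ⟨2 * M + T + |c| * (2 * M + |c| * T), fun t n => ?_⟩
  obtain ⟨hL, hR, -, -⟩ := state_eq h hγ hρ h0 t
  have hw : waveMass (a κ) c ε t ((n + 1 : ℕ) : ℤ) ≤ WallData.totalMass (1 - 2 / κ) ε :=
    le_hasSum (h.hasSum_waveMass t) _ fun x _ => WallData.waveMass_nonneg t x
  have hA : ‖amplitude (waveL (a κ) c ε t) ((n + 1 : ℕ) : ℤ)‖ ≤ M := by
    refine Real.le_sqrt_of_sq_le (le_trans ?_ hw)
    exact le_add_of_nonneg_right (sq_nonneg _)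
  have hA' : ‖amplitude (waveR (a κ) c ε t) ((n + 1 : ℕ) : ℤ)‖ ≤ M := by
    refine Real.le_sqrt_of_sq_le (le_trans ?_ hw)
    exact le_add_of_nonneg_left (sq_nonneg _)
  have hb := norm_boundPart_le β ρ t (n + 1)
  have hB : |β * ρ ^ (n + 1)| ≤ T := hs.le_tsum (n + 1) fun _ _ => abs_nonneg _
  have hcB : ‖(c : ℂ) * boundPart β ρ t (n + 1)‖ ≤ |c| * |β * ρ ^ (n + 1)| := by
    rw [norm_mul, Complex.norm_real, Real.norm_eq_abs]
    gcongr
  have hMT : 0 ≤ 2 * M + T := by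
    have : 0 ≤ T := (abs_nonneg _).trans hB
    positivity
  have hMT' : 0 ≤ 2 * M + |c| * T := by
    have : 0 ≤ T := (abs_nonneg _).trans hB
    positivity
  have h1 := abs_norm_add_sq_sub_le _ _ hA (hb.trans hB)
  have h2 := abs_norm_add_sq_sub_le _ _ hA'
    (hcB.trans (mul_le_mul_of_nonneg_left hB (abs_nonneg c)))
  have h3 := mul_le_mul_of_nonneg_right hb hMT
  have h4 := mul_le_mul_of_nonneg_right hcB hMT'
  rw [toReal_law, hL, hR, waveMass, add_sub_add_comm]
  refine (abs_add_le _ _).trans ?_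
  linarith

theorem integral_rescaledLaw_sub {κ : ℕ} {γ : ℝ} {t : ℕ} (hneg : ∀ x < 0, state κ γ t x = 0)
    {g : ℝ → ℝ} (hg : Continuous g) {K : ℝ} (hK : ∀ x, |g x| ≤ K) :
    ∫ x, g x ∂(rescaledLaw κ γ t : Measure ℝ) = g 0 +
      ∑' x : ℤ, (law κ γ t x).toReal * (g (max (x / t) 0) - g 0) := by
  have h1 := hasSum_law κ γ t
  have h2 : Summable fun x : ℤ => (law κ γ t x).toReal * g (x / t) :=
    summable_mul_of_bounded h1.summable (fun _ => ENNReal.toReal_nonneg) fun _ => hK _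
  rw [rescaledLaw, ProbabilityMeasure.coe_mk, integral_map_div_toMeasure _ _ hg hK]
  simp only [smul_eq_mul]
  have h3 : ∀ x : ℤ, (law κ γ t x).toReal * (g (max (x / t) 0) - g 0) =
      (law κ γ t x).toReal * g (x / t) - (law κ γ t x).toReal * g 0 := by
    intro x
    rcases lt_or_ge x 0 with hx | hx
    · simp [toReal_law, hneg x hx]
    · rw [max_eq_left (by positivity), mul_sub]
  simp only [h3]
  rw [h2.tsum_sub (h1.summable.mul_right _), tsum_mul_right, h1.tsum_eq]
  ring

theorem tsum_int_eq_tsum_nat_succ {F : ℤ → ℝ} (hF : ∀ x ≤ 0, F x = 0) :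
    ∑' x, F x = ∑' n : ℕ, F ((n + 1 : ℕ) : ℤ) := by
  have hinj : Function.Injective fun n : ℕ => ((n + 1 : ℕ) : ℤ) := fun m n h => by
    simpa using h
  refine (hinj.tsum_eq fun x hx => ?_).symm
  have h1 : 0 < x := by
    by_contra h1
    exact hx (hF x (not_lt.mp h1))
  exact ⟨(x - 1).toNat, by push_cast; omega⟩

/-- The general limit theorem: a fixed fraction of the walk escapes with density `f κ`, and
the rest stays near the wall. -/
theorem tendsto_integral_rescaledLaw {κ : ℕ} (hκ : 3 ≤ κ) {γ c ε β ρ : ℝ}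
    (h : WallData (a κ) (1 - 2 / κ) c ε)
    (hγ : exp (γ * I) = ε) (hρ : ρ * c = ε)
    (h0 : ∀ n : ℕ, amplitude (profile c) n = (if n = 0 then 1 else 0) - boundPart β ρ 0 n)
    (hs : Summable fun n : ℕ => |β * ρ ^ n|) {g : ℝ → ℝ} (hg : Continuous g) {K : ℝ}
    (hK : ∀ x, |g x| ≤ K) :
    Tendsto (fun t : ℕ => ∫ x, g x ∂(rescaledLaw κ γ t : Measure ℝ)) atTop
      (𝓝 (g 0 + WallData.totalMass (1 - 2 / κ) ε / 2 * (∫ x, g x ∂densityMeasure κ - g 0))) := by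
  -- Subtracting `g 0` kills the contribution of the sites near the wall.
  set u : ℝ → ℝ := fun x => g (max x 0) - g 0 with hu
  have huc : Continuous u := by fun_prop
  have hu0 : ∀ x ≤ 0, u x = 0 := fun x hx => by simp [hu, max_eq_right hx]
  have huK : ∀ x, |u x| ≤ K + K := fun x => (abs_sub _ _).trans (add_le_add (hK _) (hK _))
  have hwave := h.tendsto_tsum_waveMass_mul huc huK
  obtain ⟨D, hD⟩ := exists_abs_law_sub_le h hγ hρ h0 hs
  have hdiff : Tendsto (fun t : ℕ => ∑' n : ℕ, ((law κ γ t ((n + 1 : ℕ) : ℤ)).toReal -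
      waveMass (a κ) c ε t ((n + 1 : ℕ) : ℤ)) * u (((n + 1 : ℕ) : ℤ) / t)) atTop (𝓝 0) := by
    have hz : ∑' _ : ℕ, (0 : ℝ) = 0 := tsum_zero
    rw [← hz]
    have hsum := (((summable_nat_add_iff 1).mpr hs).mul_left D).mul_right (K + K)
    refine tendsto_tsum_of_dominated_convergence hsum (fun n => ?_)
      (Eventually.of_forall fun t n => ?_)
    · have h1 : Tendsto (fun t : ℕ => u (((n + 1 : ℕ) : ℤ) / t)) atTop (𝓝 0) := by
        have := (huc.tendsto 0).comp
          (tendsto_const_div_atTop_nhds_zero_nat ((((n + 1 : ℕ) : ℤ) : ℝ)))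
        rwa [hu0 0 le_rfl] at this
      have h2 := (tendsto_zero_iff_abs_tendsto_zero _).mp h1
      have h3 := h2.const_mul (D * |β * ρ ^ (n + 1)|)
      rw [mul_zero] at h3
      refine squeeze_zero_norm (fun t => ?_) h3
      rw [Real.norm_eq_abs, abs_mul]
      exact mul_le_mul_of_nonneg_right (hD t n) (abs_nonneg _)
    · rw [Real.norm_eq_abs, abs_mul]
      exact mul_le_mul (hD t n) (huK _) (abs_nonneg _) ((abs_nonneg _).trans (hD t n))
  have hsplit : ∀ t : ℕ, ∫ x, g x ∂(rescaledLaw κ γ t : Measure ℝ) = g 0 +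
      (∑' x : ℤ, waveMass (a κ) c ε t x * u (x / t) +
        ∑' n : ℕ, ((law κ γ t ((n + 1 : ℕ) : ℤ)).toReal -
          waveMass (a κ) c ε t ((n + 1 : ℕ) : ℤ)) * u (((n + 1 : ℕ) : ℤ) / t)) := by
    intro t
    obtain ⟨-, -, -, hneg⟩ := state_eq h hγ hρ h0 t
    rw [integral_rescaledLaw_sub hneg hg hK]
    have h1 : Summable fun x : ℤ => (law κ γ t x).toReal * u (x / t) :=
      summable_mul_of_bounded (hasSum_law κ γ t).summable (fun _ => ENNReal.toReal_nonneg)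
        fun _ => huK _
    have h2 : Summable fun x : ℤ => waveMass (a κ) c ε t x * u (x / t) :=
      summable_mul_of_bounded (h.hasSum_waveMass t).summable (WallData.waveMass_nonneg t)
        fun _ => huK _
    have h3 : ∑' n : ℕ, ((law κ γ t ((n + 1 : ℕ) : ℤ)).toReal -
          waveMass (a κ) c ε t ((n + 1 : ℕ) : ℤ)) * u (((n + 1 : ℕ) : ℤ) / t) =
        ∑' x : ℤ, ((law κ γ t x).toReal - waveMass (a κ) c ε t x) * u (x / t) := by
      rw [tsum_int_eq_tsum_nat_succ]
      intro x hx
      have h4 : (x : ℝ) ≤ 0 := by exact_mod_cast hx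
      rw [hu0 _ (div_nonpos_of_nonpos_of_nonneg h4 (Nat.cast_nonneg t)), mul_zero]
    rw [h3]
    simp only [sub_mul]
    rw [h1.tsum_sub h2]
    ring
  simp only [hsplit]
  have hlim := (hwave.add hdiff).const_add (g 0)
  convert hlim using 2
  rw [add_zero, h.integral_velocity_of_eq_zero huc hu0, integral_densityMeasure hκ h]
  have hp := Real.pi_pos
  have hcv := h.continuous_velocity
  have h5 : ∫ k in (0 : ℝ)..(Real.pi / 2), velocity (a κ) k ^ 2 * u (velocity (a κ) k) =
      (∫ k in (0 : ℝ)..(Real.pi / 2), velocity (a κ) k ^ 2 * g (velocity (a κ) k)) -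
        Real.pi / 2 * (1 - (1 - 2 / κ)) * g 0 := by
    rw [← h.integral_velocity_sq_quarter, ← intervalIntegral.integral_mul_const,
      ← intervalIntegral.integral_sub]
    · refine intervalIntegral.integral_congr fun k hk => ?_
      rw [Set.uIcc_of_le (by positivity)] at hk
      have h6 := h.velocity_nonneg hk.1 (by linarith [hk.2])
      simp only [hu, max_eq_left h6]
      ring
    · exact Continuous.intervalIntegrable (by fun_prop) _ _
    · exact Continuous.intervalIntegrable (by fun_prop) _ _
  rw [h5, WallData.totalMass]
  have hκ' : (κ : ℝ) ≠ 0 := by positivity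
  have hε := h.one_sub_eps_mul_pos.ne'
  generalize 1 - ε * (1 - 2 / (κ : ℝ)) = q at *
  field_simp
  ring

/-! ### The two phases of the wall -/

theorem wallData_zero {κ : ℕ} (hκ : 3 ≤ κ) :
    WallData (a κ) (1 - 2 / κ) ((1 - (1 - 2 / (κ : ℝ))) / a κ) 1 where
  a_pos := a_pos hκ
  b_pos := one_sub_two_div_pos hκ
  sq_add_sq := a_sq κ
  eps_sq := one_pow 2
  a_mul_c := mul_div_cancel₀ _ (a_pos hκ).ne'

theorem wallData_pi {κ : ℕ} (hκ : 3 ≤ κ) :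
    WallData (a κ) (1 - 2 / κ) ((-1 - (1 - 2 / (κ : ℝ))) / a κ) (-1) where
  a_pos := a_pos hκ
  b_pos := one_sub_two_div_pos hκ
  sq_add_sq := a_sq κ
  eps_sq := by norm_num
  a_mul_c := mul_div_cancel₀ _ (a_pos hκ).ne'

namespace WallData

variable {a b c ε : ℝ}

theorem c_sq_mul (h : WallData a b c ε) : c ^ 2 * (1 + ε * b) = 1 - ε * b := by
  have h1 : a ^ 2 * (c ^ 2 * (1 + ε * b)) = a ^ 2 * (1 - ε * b) := by
    have h2 : a ^ 2 * c ^ 2 = (ε - b) ^ 2 := by rw [← h.a_mul_c]; ring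
    linear_combination (1 + ε * b) * h2 - (1 - ε * b) * h.sq_add_sq +
      (1 + ε * b - 2 * b ^ 2) * h.eps_sq
  exact mul_left_cancel₀ (pow_ne_zero 2 h.a_pos.ne') h1

end WallData

/-- For `γ = 0` there is no bound state. -/
theorem tendsto_integral_rescaledLaw_zero {κ : ℕ} (hκ : 3 ≤ κ) {g : ℝ → ℝ} (hg : Continuous g)
    {K : ℝ} (hK : ∀ x, |g x| ≤ K) :
    Tendsto (fun t : ℕ => ∫ x, g x ∂(rescaledLaw κ 0 t : Measure ℝ)) atTop
      (𝓝 (∫ x, g x ∂densityMeasure κ)) := by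
  have h := wallData_zero hκ
  have hb := h.b_pos
  have hc : ((1 - (1 - 2 / (κ : ℝ))) / a κ) ^ 2 < 1 := by
    have := h.c_sq_mul
    nlinarith [sq_nonneg ((1 - (1 - 2 / (κ : ℝ))) / a κ)]
  have h1 := tendsto_integral_rescaledLaw hκ h (γ := 0) (β := 0) (by simp)
    (inv_mul_cancel₀ h.c_ne_zero)
    (fun n => by rw [amplitude_profile_of_lt_one hc]; simp [boundPart])
    (by simp) hg hK
  have hb1 : (1 : ℝ) - (1 - 2 / κ) ≠ 0 := by linarith [h.b_lt_one]
  have e : WallData.totalMass (1 - 2 / κ) 1 / 2 = 1 := by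
    rw [WallData.totalMass, one_mul]
    field_simp
  rw [e, one_mul, add_sub_cancel] at h1
  exact h1

/-- For `γ = π` the initial state overlaps the bound states with eigenvalues `1` and `-1`. -/
theorem tendsto_integral_rescaledLaw_pi {κ : ℕ} (hκ : 3 ≤ κ) {g : ℝ → ℝ} (hg : Continuous g)
    {K : ℝ} (hK : ∀ x, |g x| ≤ K) :
    Tendsto (fun t : ℕ => ∫ x, g x ∂(rescaledLaw κ Real.pi t : Measure ℝ)) atTop
      (𝓝 (C κ * g 0 + (1 - C κ) * ∫ x, g x ∂densityMeasure κ)) := by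
  have h := wallData_pi hκ
  have hb := h.b_pos
  have hb1 := h.b_lt_one
  set c := (-1 - (1 - 2 / (κ : ℝ))) / a κ with hcdef
  have hc : 1 < c ^ 2 := by
    have := h.c_sq_mul
    nlinarith [sq_nonneg c]
  have hρ : -c⁻¹ * c = -1 := by rw [neg_mul, inv_mul_cancel₀ h.c_ne_zero]
  have hρ1 : |(-c⁻¹)| < 1 := by
    rw [abs_neg, abs_inv]
    exact inv_lt_one_of_one_lt₀ ((one_lt_sq_iff_one_lt_abs c).mp hc)
  have hs : Summable fun n : ℕ => |(1 - c⁻¹ ^ 2) * (-c⁻¹) ^ n| := by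
    simp only [abs_mul, abs_pow]
    exact (summable_geometric_of_lt_one (abs_nonneg _) hρ1).mul_left _
  have h1 := tendsto_integral_rescaledLaw hκ h (γ := Real.pi) (β := 1 - c⁻¹ ^ 2)
    (by simp [Complex.exp_pi_mul_I]) hρ
    (fun n => by
      rw [amplitude_profile_of_one_lt hc (ρ := -c⁻¹) (by
        have := h.c_ne_zero
        field_simp)]
      simp [boundPart]) hs hg hK
  have hκ3 : (3 : ℝ) ≤ κ := by exact_mod_cast hκ
  have e : WallData.totalMass (1 - 2 / κ) (-1) / 2 = 1 - C κ := by
    have h2 : (κ : ℝ) - 1 ≠ 0 := by linarith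
    have h3 : (κ : ℝ) ≠ 0 := by linarith
    have h4 : 1 - -1 * (1 - 2 / (κ : ℝ)) = 2 * (κ - 1) / κ := by field_simp; ring
    rw [WallData.totalMass, C, h4]
    field_simp
    ring
  rw [e] at h1
  convert h1 using 2
  ring

theorem C_mem_Icc {κ : ℕ} (hκ : 3 ≤ κ) : C κ ∈ Set.Icc (0 : ℝ) 1 := by
  have hκ3 : (3 : ℝ) ≤ κ := by exact_mod_cast hκ
  constructor
  · exact div_nonneg (by linarith) (by linarith)
  · rw [C, div_le_one (by linarith)]
    linarith

theorem isProbabilityMeasure_mixedMeasure {κ : ℕ} (hκ : 3 ≤ κ)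
    (hA : IsProbabilityMeasure (densityMeasure κ)) : IsProbabilityMeasure (mixedMeasure κ) := by
  have hC := C_mem_Icc hκ
  constructor
  simp only [mixedMeasure, Measure.add_apply, Measure.smul_apply, measure_univ, smul_eq_mul,
    mul_one]
  rw [← ENNReal.ofReal_add hC.1 (by linarith [hC.2]), add_sub_cancel, ENNReal.ofReal_one]

theorem integral_mixedMeasure {κ : ℕ} (hκ : 3 ≤ κ) (hA : IsProbabilityMeasure (densityMeasure κ))
    {g : ℝ → ℝ} (hg : Continuous g) {K : ℝ} (hK : ∀ x, |g x| ≤ K) :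
    ∫ x, g x ∂mixedMeasure κ = C κ * g 0 + (1 - C κ) * ∫ x, g x ∂densityMeasure κ := by
  have hC := C_mem_Icc hκ
  have hi : ∀ (μ : Measure ℝ) [IsProbabilityMeasure μ] (r : ℝ),
      Integrable g (ENNReal.ofReal r • μ) := fun μ _ r =>
    (Integrable.of_bound hg.aestronglyMeasurable K (ae_of_all _ hK)).smul_measure
      ENNReal.ofReal_ne_top
  rw [mixedMeasure, integral_add_measure (hi _ _) (hi _ _), integral_smul_measure,
    integral_smul_measure, integral_dirac, ENNReal.toReal_ofReal hC.1,
    ENNReal.toReal_ofReal (by linarith [hC.2])]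
  rfl

end WallWalk
end

theorem theorem2 (κ : ℕ) (hκ : 3 ≤ κ) :
    (∃ hA : IsProbabilityMeasure (WallWalk.densityMeasure κ),
      Tendsto (fun t : ℕ => WallWalk.rescaledLaw κ 0 t) atTop
        (𝓝 (⟨WallWalk.densityMeasure κ, hA⟩ : ProbabilityMeasure ℝ))) ∧
    (∃ hB : IsProbabilityMeasure (WallWalk.mixedMeasure κ),
      Tendsto (fun t : ℕ => WallWalk.rescaledLaw κ Real.pi t) atTop
        (𝓝 (⟨WallWalk.mixedMeasure κ, hB⟩ : ProbabilityMeasure ℝ))) ∧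
    (∀ x : ℝ, WallWalk.f κ x =
      κ * x ^ 2 * WallWalk.konnoDensity x (WallWalk.a κ) * (Set.Ici (0 : ℝ)).indicator 1 x) := by
  have hA := WallWalk.isProbabilityMeasure_densityMeasure hκ (WallWalk.wallData_zero hκ)
  refine ⟨⟨hA, ProbabilityMeasure.tendsto_iff_forall_integral_tendsto.mpr fun g => ?_⟩,
    ⟨WallWalk.isProbabilityMeasure_mixedMeasure hκ hA,
      ProbabilityMeasure.tendsto_iff_forall_integral_tendsto.mpr fun g => ?_⟩,
    WallWalk.f_eq_konnoDensity hκ⟩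
  · exact WallWalk.tendsto_integral_rescaledLaw_zero hκ g.continuous g.norm_coe_le_norm
  · simp only [ProbabilityMeasure.coe_mk]
    rw [WallWalk.integral_mixedMeasure hκ hA g.continuous g.norm_coe_le_norm]
    exact WallWalk.tendsto_integral_rescaledLaw_pi hκ g.continuous g.norm_coe_le_norm
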